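/- Let $q=2^{2m+1}\ge 8$ with $m$ a natural number, let $\mathbb F$ be a field with $q$ elements, and put $t=2^{m+1}=\sqrt{2q}$. Let $S=\mathrm{Sz}(q)$ be the Suzuki group, that is, the subgroup of $\mathrm{SL}_4(\mathbb F)$ generated by the matrices $$w(a,b)=\begin{pmatrix}1&0&0&0\\ a&1&0&0\\ b&a^{t}&1&0\\ a^{2+t}+ab+b^{t}&a^{1+t}+b&a&1\end{pmatrix}\qquad(a,b\in\mathbb F),$$ the diagonal matrices $\mathrm{diag}(\kappa^{1+t},\kappa,\kappa^{-1},\kappa^{-1-t})$ with $\kappa\in\mathbb F^{\times}$, and the antidiagonal permutation matrix. For a finite group $G$ let $m_i(G)$ be the number of elements of order $i$ in $G$, let $\omega(G)$ be the set of orders of elements of $G$, and let $\mathrm{nse}(G)=\{m_i(G) : i\in\omega(G)\}$. Let $\varphi$ be Euler's totient function. Then (a) $m_1(S)=1$, $m_2(S)=(q-1)(q^2+1)$ and $m_4(S)=q(q-1)(q^2+1)$; (b) $m_i(S)=\varphi(i)\,q^2(q-\sqrt{2q}+1)(q-1)/4$ for every $i>1$ dividing $q+\sqrt{2q}+1$,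 and $m_i(S)=\varphi(i)\,q^2(q+\sqrt{2q}+1)(q-1)/4$ for every $i>1$ dividing $q-\sqrt{2q}+1$; (c) $m_i(S)=\varphi(i)\,q^2(q^2+1)/2$ for every $i>1$ dividing $q-1$; and the set $\mathrm{nse}(S)$ consists of exactly the numbers listed in (a), (b) and (c). -/

import Mathlib

open scoped MatrixGroups

/-- `spectrumOrders G` is the set of orders of the elements of `G`, written `ω(G)`. -/
def spectrumOrders (G : Type*) [Group G] : Set ℕ :=
  {i | ∃ g : G, orderOf g = i}

/-- `numOrder G i` is the number of elements of order `i` in `G`, written `m_i(G)`. -/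
noncomputable def numOrder (G : Type*) [Group G] (i : ℕ) : ℕ :=
  Nat.card {g : G // orderOf g = i}

/-- `nse G` is the set of the numbers `m_i(G)`, where `i` runs over the orders of elements
of `G`. -/
def nse (G : Type*) [Group G] : Set ℕ :=
  {n | ∃ i ∈ spectrumOrders G, n = numOrder G i}

namespace Suzuki

variable {F : Type*} [Field F]

/-- The lower unitriangular matrix `w(a, b)`, where `x ↦ x ^ 2 ^ (m + 1)` is the field
automorphism `π` when `F` has `2 ^ (2 * m + 1)` elements. -/
def w (m : ℕ) (a b : F) : SL(4, F) :=
  ⟨!![1, 0, 0, 0;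
      a, 1, 0, 0;
      b, a ^ 2 ^ (m + 1), 1, 0;
      a ^ 2 * a ^ 2 ^ (m + 1) + a * b + b ^ 2 ^ (m + 1), a * a ^ 2 ^ (m + 1) + b, a, 1], by
    simp [Matrix.det_succ_row_zero, Fin.sum_univ_succ]⟩

/-- The diagonal matrix `diag(κ ^ (1 + t), κ, κ⁻¹, κ ^ (-(1 + t)))`, where `t = 2 ^ (m + 1)`. -/
def d (m : ℕ) (κ : Fˣ) : SL(4, F) :=
  ⟨Matrix.diagonal ![(κ : F) ^ (1 + 2 ^ (m + 1)), (κ : F), (κ : F)⁻¹,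
      ((κ : F) ^ (1 + 2 ^ (m + 1)))⁻¹], by
    rw [Matrix.det_diagonal]
    simp [Fin.prod_univ_succ]⟩

variable (F) in
/-- The antidiagonal permutation matrix. -/
def antidiag : SL(4, F) :=
  ⟨!![0, 0, 0, 1;
      0, 0, 1, 0;
      0, 1, 0, 0;
      1, 0, 0, 0], by
    simp [Matrix.det_succ_row_zero, Fin.sum_univ_succ, Fin.succAbove]
    ring⟩

/-- The Suzuki group `Sz(q)` over a field `F` with `q = 2 ^ (2 * m + 1)` elements, as Suzuki's
group of `4 × 4` matrices: the subgroup of `SL(4, F)` that is generated by all the `w(a, b)`,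
all the diagonal matrices `d κ` and the antidiagonal permutation matrix. -/
def Sz (m : ℕ) (F : Type*) [Field F] : Subgroup SL(4, F) :=
  Subgroup.closure
    ({g | ∃ a b : F, g = w m a b} ∪ {g | ∃ κ : Fˣ, g = d m κ} ∪ {antidiag F})

end Suzuki

/-! The conjugacy classes of S are never determined exactly. For each listed order a lower bound for
m_i(S) is proved; the bounds add up to |S| = q²(q²+1)(q-1), so all of them are equalities and no
other order occurs (`numOrder_Sz_eq`). Such bounds need only upper estimates: if φ(i) elements of
order i have centralizers of order at most c, and each is conjugate to at most k of them, then
φ(i)|S| ≤ c·k·m_i(S) (`card_mul_card_le_mul_numOrder`).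

The order of S comes from a Bruhat decomposition (`card_Sz`). It rests on the anisotropy of the
ovoid form (`ovoidForm_eq_zero`), which holds because the twist x ↦ x^t squares to the Frobenius map
x ↦ x². Conjugating the nontrivial `w a b` by the q²+1 coset representatives gives the bounds for
orders 2 and 4.

For i dividing n = q ± t + 1, the decomposition shows that the characteristic polynomial of an
element of S depends only on its trace, and every trace occurs (`charpoly_of_mem_Sz`,
`exists_trace_eq`). So each primitive i-th root of unity x is an eigenvalue of some element of S.
Its conjugates x, x^q, x⁻¹, x^(-q) are distinct, so the centralizer acts faithfully by scalars on an
eigenvector. By `torus_of_root` the eigenvalues of elements of S lie in F or are roots of unity of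
order dividing q+t+1 or q-t+1, and this forces the scalars to be n-th roots of unity. Hence c = n
and k = 4. For i dividing q-1 the diagonal torus gives c = q-1 and k = 2. -/

namespace Suzuki

variable {F : Type*} [Field F] {m : ℕ}

/-- The quaternary form whose zero set describes the Suzuki–Tits ovoid in affine coordinates. -/
def ovoidForm (m : ℕ) (a b : F) : F :=
  a ^ 2 * a ^ 2 ^ (m + 1) + a * b + b ^ 2 ^ (m + 1)

/-! ### The twist x ↦ x^t and the anisotropy of the ovoid form -/

section Twist

lemma twist_add [CharP F 2] (m : ℕ) (x y : F) :
    (x + y) ^ 2 ^ (m + 1) = x ^ 2 ^ (m + 1) + y ^ 2 ^ (m + 1) :=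
  add_pow_char_pow x y 2 _

/-- t² = 2q and x^q = x, so the twist is a square root of the Frobenius map. -/
lemma twist_twist [Finite F] (hF : Nat.card F = 2 ^ (2 * m + 1)) (x : F) :
    (x ^ 2 ^ (m + 1)) ^ 2 ^ (m + 1) = x ^ 2 := by
  have := Fintype.ofFinite F
  have h : x ^ 2 ^ (2 * m + 1) = x := by
    rw [← hF, Nat.card_eq_fintype_card, FiniteField.pow_card]
  calc (x ^ 2 ^ (m + 1)) ^ 2 ^ (m + 1) = (x ^ 2 ^ (2 * m + 1)) ^ 2 := by
        rw [← pow_mul, ← pow_mul]; congr 1; ring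
    _ = x ^ 2 := by rw [h]

lemma twist_injective [Finite F] (hF : Nat.card F = 2 ^ (2 * m + 1)) [CharP F 2] {x y : F}
    (h : x ^ 2 ^ (m + 1) = y ^ 2 ^ (m + 1)) : x = y := by
  have h2 : x ^ 2 = y ^ 2 := by rw [← twist_twist hF, h, twist_twist hF]
  have : (x - y) ^ 2 = 0 := by rw [sub_pow_char, h2, sub_self]
  exact sub_eq_zero.1 (pow_eq_zero_iff two_ne_zero |>.1 this)

lemma twist_surjective [Finite F] (hF : Nat.card F = 2 ^ (2 * m + 1)) [CharP F 2] (y : F) :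
    ∃ x : F, x ^ 2 ^ (m + 1) = y :=
  (Finite.injective_iff_surjective (f := fun x : F => x ^ 2 ^ (m + 1))).1
    (fun _ _ h => twist_injective hF h) y

lemma twist_eq_one [Finite F] (hF : Nat.card F = 2 ^ (2 * m + 1)) [CharP F 2] {x : F}
    (h : x ^ 2 ^ (m + 1) = 1) : x = 1 :=
  twist_injective hF (by rw [h, one_pow])

/-- Twisting the hypothesis gives x^t·x² = 1; comparison with x·x^t = 1 leaves x = 1. This and the
next lemma separate the diagonal entries of `d m κ`. -/
lemma mul_twist_eq_one [Finite F] (hF : Nat.card F = 2 ^ (2 * m + 1)) [CharP F 2] {x : F}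
    (h : x * x ^ 2 ^ (m + 1) = 1) : x = 1 := by
  have h1 : x ^ 2 ^ (m + 1) * x ^ 2 = 1 := by
    have := congrArg (· ^ 2 ^ (m + 1)) h
    simpa [mul_pow, twist_twist hF] using this
  have hx : x ≠ 0 := by rintro rfl; simp at h
  have h2 : x * (x * x ^ 2 ^ (m + 1)) = 1 := by linear_combination h1
  rwa [h, mul_one] at h2

lemma sq_mul_twist_eq_one [Finite F] (hF : Nat.card F = 2 ^ (2 * m + 1)) [CharP F 2] {x : F}
    (h : x ^ 2 * x ^ 2 ^ (m + 1) = 1) : x = 1 := by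
  have h1 : (x ^ 2 ^ (m + 1)) ^ 2 * x ^ 2 = 1 := by
    have := congrArg (· ^ 2 ^ (m + 1)) h
    simpa [mul_pow, twist_twist hF, pow_right_comm x 2] using this
  have h2 : (x * x ^ 2 ^ (m + 1)) ^ 2 = 1 ^ 2 := by linear_combination h1
  have h3 : (x * x ^ 2 ^ (m + 1) - 1) ^ 2 = 0 := by rw [sub_pow_char, h2, sub_self]
  exact mul_twist_eq_one hF (sub_eq_zero.1 (pow_eq_zero_iff two_ne_zero |>.1 h3))

/-- With A = a^t and B = b^t, twisting a²A + ab + B = 0 gives A²a² + AB + b² = 0. Eliminating B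
leaves b(Aa + b) = 0, and either factor reduces the form to a²A. -/
lemma ovoidForm_eq_zero [Finite F] (hF : Nat.card F = 2 ^ (2 * m + 1)) [CharP F 2] {a b : F}
    (h : ovoidForm m a b = 0) : a = 0 ∧ b = 0 := by
  have hA := twist_twist hF a
  have hB := twist_twist hF b
  have h2 := congrArg (· ^ 2 ^ (m + 1)) h
  simp only [ovoidForm, twist_add, mul_pow, pow_right_comm a 2, hA, hB] at h h2
  rw [zero_pow (by positivity)] at h2
  by_cases ha : a = 0
  · subst ha
    simp at h
    exact ⟨rfl, h⟩
  exfalso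
  have hA0 : a ^ 2 ^ (m + 1) ≠ 0 := pow_ne_zero _ ha
  have h3 : b * (a ^ 2 ^ (m + 1) * a + b) = 0 := by
    clear hA hB
    generalize a ^ 2 ^ (m + 1) = A at *
    generalize b ^ 2 ^ (m + 1) = B at *
    grind
  rcases mul_eq_zero.1 h3 with h4 | h4
  · subst h4
    simp_all
  · have h5 : b = a ^ 2 ^ (m + 1) * a := by
      clear hA hB h h2 h3
      generalize a ^ 2 ^ (m + 1) = A at *
      grind
    have h6 : b ^ 2 ^ (m + 1) = a ^ 2 * a ^ 2 ^ (m + 1) := by rw [h5, mul_pow, hA]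
    rw [h6] at h
    clear hA hB h2 h3 h6 h4
    generalize a ^ 2 ^ (m + 1) = A at *
    subst h5
    have : a ^ 2 * A = 0 := by grind
    simp_all

end Twist

/-! ### Relations between the generators -/

section Relations

lemma coe_w (a b : F) : (w m a b : Matrix (Fin 4) (Fin 4) F) = !![1, 0, 0, 0;
      a, 1, 0, 0;
      b, a ^ 2 ^ (m + 1), 1, 0;
      a ^ 2 * a ^ 2 ^ (m + 1) + a * b + b ^ 2 ^ (m + 1), a * a ^ 2 ^ (m + 1) + b, a, 1] := rfl

lemma coe_d (κ : Fˣ) : (d m κ : Matrix (Fin 4) (Fin 4) F) =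
    !![(κ : F) * (κ : F) ^ 2 ^ (m + 1), 0, 0, 0; 0, (κ : F), 0, 0; 0, 0, (κ : F)⁻¹, 0;
      0, 0, 0, ((κ : F) * (κ : F) ^ 2 ^ (m + 1))⁻¹] := by
  ext i j
  fin_cases i <;> fin_cases j <;> simp [d, pow_add]

lemma coe_antidiag : (antidiag F : Matrix (Fin 4) (Fin 4) F) =
    !![0, 0, 0, 1; 0, 0, 1, 0; 0, 1, 0, 0; 1, 0, 0, 0] := rfl

/-- Left multiplication by `antidiag` reverses the order of the rows. -/
lemma antidiag_mul_apply (g : SL(4, F)) (i j : Fin 4) : (antidiag F * g) i j = g i.rev j := by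
  rw [Matrix.SpecialLinearGroup.coe_mul, coe_antidiag]
  fin_cases i <;> simp [Matrix.mul_apply, Fin.sum_univ_four]

/-- Right multiplication by `antidiag` reverses the order of the columns. -/
lemma mul_antidiag_apply (g : SL(4, F)) (i j : Fin 4) : (g * antidiag F) i j = g i j.rev := by
  rw [Matrix.SpecialLinearGroup.coe_mul, coe_antidiag]
  fin_cases j <;> simp [Matrix.mul_apply, Fin.sum_univ_four]

lemma antidiag_mul_antidiag : antidiag F * antidiag F = 1 := by
  ext i j
  rw [antidiag_mul_apply, coe_antidiag]
  fin_cases i <;> fin_cases j <;> simp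

lemma d_mul_d (κ l : Fˣ) : d m κ * d m l = d m (κ * l) := by
  ext i j
  rw [Matrix.SpecialLinearGroup.coe_mul, coe_d, coe_d, coe_d]
  fin_cases i <;> fin_cases j <;> simp [Matrix.mul_apply, Fin.sum_univ_four, mul_pow] <;> ring

lemma d_one : d m (1 : Fˣ) = 1 := by
  ext i j
  rw [coe_d]
  fin_cases i <;> fin_cases j <;> simp

lemma d_mul_antidiag (κ : Fˣ) : d m κ * antidiag F = antidiag F * d m κ⁻¹ := by
  ext i j
  rw [mul_antidiag_apply, antidiag_mul_apply, coe_d, coe_d]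
  fin_cases i <;> fin_cases j <;> simp [Fin.rev, mul_comm]

lemma d_mul_w (hF : Nat.card F = 2 ^ (2 * m + 1)) [Finite F] (κ : Fˣ) (a b : F) :
    d m κ * w m a b = w m (a * ((κ : F) ^ 2 ^ (m + 1))⁻¹)
      (b * ((κ : F)^2 * (κ : F) ^ 2 ^ (m + 1))⁻¹) * d m κ := by
  ext i j
  have h := twist_twist hF (κ : F)
  have h0 : (κ : F) ≠ 0 := κ.ne_zero
  rw [Matrix.SpecialLinearGroup.coe_mul, Matrix.SpecialLinearGroup.coe_mul, coe_d, coe_w, coe_w]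
  have h1 : (κ : F) ^ 2 ^ (m + 1) ≠ 0 := pow_ne_zero _ h0
  fin_cases i <;> fin_cases j <;>
    simp [Matrix.mul_apply, Fin.sum_univ_four, mul_pow, inv_pow, h, pow_right_comm _ 2] <;>
    clear h <;> generalize (κ : F) ^ 2 ^ (m + 1) = k at * <;> field_simp

lemma w_zero : w m (0 : F) 0 = 1 := by
  ext i j
  rw [coe_w]
  fin_cases i <;> fin_cases j <;> simp

variable [CharP F 2]

lemma w_mul_w [Finite F] (hF : Nat.card F = 2 ^ (2 * m + 1)) (a b c e : F) :
    w m a b * w m c e = w m (a + c) (b + e + a ^ 2 ^ (m + 1) * c) := by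
  ext i j
  rw [Matrix.SpecialLinearGroup.coe_mul, coe_w, coe_w, coe_w]
  have hA := twist_twist hF a
  fin_cases i <;> fin_cases j <;>
    simp [Matrix.mul_apply, Fin.sum_univ_four, twist_add, mul_pow, hA] <;>
    clear hA <;>
    generalize a ^ 2 ^ (m + 1) = A <;> generalize c ^ 2 ^ (m + 1) = C <;>
    generalize b ^ 2 ^ (m + 1) = B <;> generalize e ^ 2 ^ (m + 1) = E <;> grind

lemma w_inv [Finite F] (hF : Nat.card F = 2 ^ (2 * m + 1)) (a b : F) :
    (w m a b)⁻¹ = w m a (b + a * a ^ 2 ^ (m + 1)) := by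
  rw [inv_eq_iff_mul_eq_one, w_mul_w hF, ← w_zero (m := m)]
  congr 1 <;> grind

lemma w_sq [Finite F] (hF : Nat.card F = 2 ^ (2 * m + 1)) (a b : F) :
    w m a b ^ 2 = w m 0 (a * a ^ 2 ^ (m + 1)) := by
  rw [sq, w_mul_w hF]
  congr 1 <;> grind

/-- The commutation relation that moves `antidiag` past a nontrivial `w a b`. -/
lemma antidiag_mul_w_mul_antidiag [Finite F] (hF : Nat.card F = 2 ^ (2 * m + 1)) (a b : F)
    (h : a ≠ 0 ∨ b ≠ 0) : ∃ a' b' c e : F, ∃ κ : Fˣ,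
    antidiag F * w m a b * antidiag F = w m a' b' * d m κ * antidiag F * w m c e := by
  have hf : ovoidForm m a b ≠ 0 := fun h0 => by
    have := ovoidForm_eq_zero hF h0
    tauto
  set f := ovoidForm m a b with hfdef
  have hft : f ^ 2 ^ (m + 1) ≠ 0 := pow_ne_zero _ hf
  have hff := twist_twist hF f
  -- The witnesses are forced. The last columns of the two sides give κ^(1+t) = f, a' = b/f, b' =
  -- a/f; the first rows give c and c·c^t + e = a/f. The equation for κ is solved by f^t/f =
  -- f^(t-1), since t² - 1 = 2q - 1 and f^q = f.
  set c := (a * a ^ 2 ^ (m + 1) + b) / f with hc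
  refine ⟨b / f, a / f, c, a / f + c * c ^ 2 ^ (m + 1),
    Units.mk0 (f ^ 2 ^ (m + 1) / f) (div_ne_zero hft hf), ?_⟩
  have hA := twist_twist hF a
  have hB := twist_twist hF b
  have hk : f ^ 2 ^ (m + 1) / f * (f ^ 2 ^ (m + 1) / f) ^ 2 ^ (m + 1) = f := by
    rw [div_pow, hff]
    field_simp
  have h2 : f ^ 2 ^ (m + 1) =
      (a ^ 2 ^ (m + 1)) ^ 2 * a ^ 2 + a ^ 2 ^ (m + 1) * b ^ 2 ^ (m + 1) + b ^ 2 := by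
    rw [hfdef, ovoidForm, twist_add, twist_add, mul_pow, mul_pow, hA, hB, pow_right_comm]
  have hct : c ^ 2 ^ (m + 1) = (a ^ 2 ^ (m + 1) * a ^ 2 + b ^ 2 ^ (m + 1)) / f ^ 2 ^ (m + 1) := by
    rw [hc, div_pow, twist_add, mul_pow, hA]
  have hctt := twist_twist hF c
  have hf2 : f = a ^ 2 * a ^ 2 ^ (m + 1) + a * b + b ^ 2 ^ (m + 1) := hfdef
  have hLHS (i j : Fin 4) := by
    have := mul_antidiag_apply (antidiag F * w m a b) i j
    rwa [antidiag_mul_apply, coe_w] at this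
  have hRHS : (antidiag F * w m c (a / f + c * c ^ 2 ^ (m + 1)) : Matrix (Fin 4) (Fin 4) F) =
      !![c ^ 2 * c ^ 2 ^ (m + 1) + c * (a / f + c * c ^ 2 ^ (m + 1)) +
          (a ^ 2 ^ (m + 1) / f ^ 2 ^ (m + 1) + c ^ 2 ^ (m + 1) * c ^ 2), a / f, c, 1;
        a / f + c * c ^ 2 ^ (m + 1), c ^ 2 ^ (m + 1), 1, 0; c, 1, 0, 0; 1, 0, 0, 0] := by
    ext i j
    rw [coe_antidiag, coe_w]
    fin_cases i <;> fin_cases j <;>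
      simp [Matrix.mul_apply, Fin.sum_univ_four, twist_add, div_pow, mul_pow, hctt]
    grind
  ext i j
  rw [hLHS, mul_assoc, mul_assoc, Matrix.SpecialLinearGroup.coe_mul,
    Matrix.SpecialLinearGroup.coe_mul, Matrix.SpecialLinearGroup.coe_mul, hRHS, coe_w, coe_d]
  simp only [Units.val_mk0, hk]
  rw [div_pow b f (2 ^ (m + 1)), div_pow a f (2 ^ (m + 1)), hct]
  clear hRHS hLHS hA hB hk hctt hff hct hfdef
  clear_value f c
  generalize a ^ 2 ^ (m + 1) = A at *
  generalize b ^ 2 ^ (m + 1) = B at *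
  generalize f ^ 2 ^ (m + 1) = g at *
  have hc' : c * f = a * A + b := by rw [hc]; field_simp
  clear hc hF
  fin_cases i <;> fin_cases j <;>
    simp [Matrix.mul_apply, Fin.sum_univ_four, Fin.rev] <;> field_simp <;> grind

end Relations

end Suzuki

namespace Suzuki

variable {F : Type*} [Field F] {m : ℕ}

/-! ### Bruhat decomposition and the order of the group -/

section Bruhat

lemma w_mem_Sz (a b : F) : w m a b ∈ Sz m F :=
  Subgroup.subset_closure (Or.inl (Or.inl ⟨a, b, rfl⟩))

lemma d_mem_Sz (κ : Fˣ) : d m κ ∈ Sz m F :=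
  Subgroup.subset_closure (Or.inl (Or.inr ⟨κ, rfl⟩))

lemma antidiag_mem_Sz : antidiag F ∈ Sz m F :=
  Subgroup.subset_closure (Or.inr rfl)

lemma w_injective {a b c e : F} (h : w m a b = w m c e) : a = c ∧ b = e := by
  have h1 := congrArg (fun g : SL(4, F) => g 1 0) h
  have h2 := congrArg (fun g : SL(4, F) => g 2 0) h
  simpa [coe_w] using And.intro h1 h2

/-- Representatives of the left cosets of the Borel subgroup, indexed by the points of the
ovoid. -/
def cosetRep (m : ℕ) : Option (F × F) → SL(4, F)
  | none => 1
  | some v => w m v.1 v.2 * antidiag F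

lemma cosetRep_mem_Sz (o : Option (F × F)) : cosetRep m o ∈ Sz m F := by
  rcases o with _ | v
  · exact one_mem _
  · exact mul_mem (w_mem_Sz _ _) antidiag_mem_Sz

lemma w_mul_d_mul_w_apply_zero_three (a b c e : F) (κ : Fˣ) :
    (w m a b * d m κ * w m c e) 0 3 = 0 := by
  rw [Matrix.SpecialLinearGroup.coe_mul, Matrix.SpecialLinearGroup.coe_mul, coe_w, coe_d, coe_w]
  simp [Matrix.mul_apply, Fin.sum_univ_four]

/-- A nontrivial `w a b` fixes no row vector with nonzero last entry. -/
lemma apply_zero_three_eq_zero {a b a' b' : F} {h : SL(4, F)} (hab : a ≠ 0 ∨ b ≠ 0)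
    (hh : h * w m a b = w m a' b' * h) : h 0 3 = 0 := by
  by_contra h0
  have h2 := congrArg (fun g : SL(4, F) => g 0 2) hh
  have h1 := congrArg (fun g : SL(4, F) => g 0 1) hh
  simp only [Matrix.SpecialLinearGroup.coe_mul, coe_w, Matrix.mul_apply, Fin.sum_univ_four] at h1 h2
  simp [h0] at h2
  subst h2
  simp [h0] at h1
  simp [h1] at hab

lemma inv_antidiag : (antidiag F)⁻¹ = antidiag F := by
  rw [inv_eq_iff_mul_eq_one, antidiag_mul_antidiag]

lemma inv_d (κ : Fˣ) : (d m κ)⁻¹ = d m κ⁻¹ := by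
  rw [inv_eq_iff_mul_eq_one, d_mul_d, mul_inv_cancel, d_one]

/-- The Bruhat parametrization of the Suzuki group. -/
def bruhat (m : ℕ) (x : Option (F × F) × F × F × Fˣ) : SL(4, F) :=
  cosetRep m x.1 * (w m x.2.1 x.2.2.1 * d m x.2.2.2)

lemma bruhat_mem_Sz (x : Option (F × F) × F × F × Fˣ) : bruhat m x ∈ Sz m F :=
  mul_mem (cosetRep_mem_Sz _) (mul_mem (w_mem_Sz _ _) (d_mem_Sz _))

variable [CharP F 2] [Finite F]

lemma inv_w_mul_w (hF : Nat.card F = 2 ^ (2 * m + 1)) (a b c e : F) :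
    ∃ x y, (w m a b)⁻¹ * w m c e = w m x y := by
  rw [w_inv hF, w_mul_w hF]
  exact ⟨_, _, rfl⟩

/-- For two representatives in the big cell the corner entry is the ovoid form of the quotient of
their unipotent parts, so anisotropy applies. -/
lemma cosetRep_eq_of_apply_eq_zero (hF : Nat.card F = 2 ^ (2 * m + 1)) {o o' : Option (F × F)}
    (h : ((cosetRep m o)⁻¹ * cosetRep m o') 0 3 = 0) : o = o' := by
  rcases o with _ | v <;> rcases o' with _ | v'
  · rfl
  · simp only [cosetRep, inv_one, one_mul, mul_antidiag_apply, coe_w] at h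
    simp [Fin.rev] at h
  · simp only [cosetRep, mul_inv_rev, mul_one, inv_antidiag, antidiag_mul_apply, w_inv hF,
      coe_w] at h
    simp [Fin.rev] at h
  · obtain ⟨x, y, hxy⟩ := inv_w_mul_w hF v.1 v.2 v'.1 v'.2
    have : (cosetRep m (some v))⁻¹ * cosetRep m (some v') =
        antidiag F * (w m x y * antidiag F) := by
      rw [← hxy]
      simp only [cosetRep, mul_inv_rev, inv_antidiag, mul_assoc]
    rw [this, antidiag_mul_apply, mul_antidiag_apply, coe_w] at h
    have hf : ovoidForm m x y = 0 := h
    obtain ⟨rfl, rfl⟩ := ovoidForm_eq_zero hF hf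
    rw [w_zero, inv_mul_eq_one] at hxy
    obtain ⟨h1, h2⟩ := w_injective hxy
    rw [Prod.ext h1 h2]

lemma bruhat_injective (hF : Nat.card F = 2 ^ (2 * m + 1)) :
    Function.Injective (bruhat (F := F) m) := by
  rintro ⟨o, a, b, κ⟩ ⟨o', a', b', κ'⟩ h
  simp only [bruhat] at h
  have h1 : (cosetRep m o)⁻¹ * cosetRep m o' =
      w m a b * d m (κ * κ'⁻¹) * (w m a' b')⁻¹ := by
    rw [inv_mul_eq_iff_eq_mul]
    calc cosetRep m o' = cosetRep m o' * (w m a' b' * d m κ') * (d m κ')⁻¹ * (w m a' b')⁻¹ := by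
          group
      _ = _ := by rw [← h, ← d_mul_d, ← inv_d]; simp only [mul_assoc]
  have ho : o = o' := by
    apply cosetRep_eq_of_apply_eq_zero hF
    rw [h1, w_inv hF, w_mul_d_mul_w_apply_zero_three]
  subst ho
  have h2 := mul_left_cancel h
  have h3 : κ = κ' := by
    have := congrArg (fun g : SL(4, F) => g 1 1) h2
    simp only [Matrix.SpecialLinearGroup.coe_mul, coe_w, coe_d, Matrix.mul_apply,
      Fin.sum_univ_four] at this
    exact Units.ext (by simpa using this)
  subst h3
  obtain ⟨h4, h5⟩ := w_injective (mul_right_cancel h2)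
  rw [h4, h5]

lemma exists_w_mul_bruhat (hF : Nat.card F = 2 ^ (2 * m + 1)) (a b : F)
    (x : Option (F × F) × F × F × Fˣ) : ∃ y, w m a b * bruhat m x = bruhat m y := by
  obtain ⟨_ | v, c, e, κ⟩ := x
  · exact ⟨⟨none, _, _, κ⟩, by
      simp only [bruhat, cosetRep, one_mul]; rw [← mul_assoc, w_mul_w hF]⟩
  · exact ⟨⟨some (_, _), c, e, κ⟩, by
      simp only [bruhat, cosetRep]; rw [← mul_assoc (w m a b), ← mul_assoc (w m a b), w_mul_w hF]⟩

omit [CharP F 2] in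
lemma exists_d_mul_bruhat (hF : Nat.card F = 2 ^ (2 * m + 1)) (l : Fˣ)
    (x : Option (F × F) × F × F × Fˣ) : ∃ y, d m l * bruhat m x = bruhat m y := by
  obtain ⟨_ | v, c, e, κ⟩ := x
  · exact ⟨⟨none, _, _, l * κ⟩, by
      simp only [bruhat, cosetRep, one_mul]; rw [← mul_assoc, d_mul_w hF, mul_assoc, d_mul_d]⟩
  · have : d m l * bruhat m (some v, c, e, κ) =
        d m l * w m v.1 v.2 * antidiag F * (w m c e * d m κ) := by
      simp only [bruhat, cosetRep, mul_assoc]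
    rw [this, d_mul_w hF, mul_assoc (w m _ _), d_mul_antidiag]
    have hassoc (x y z u v : SL(4, F)) : x * (y * z) * (u * v) = x * y * (z * u * v) := by
      simp only [mul_assoc]
    rw [hassoc, d_mul_w hF, mul_assoc (w m _ _) (d m _) (d m _), d_mul_d]
    exact ⟨⟨some (_, _), _, _, _⟩, rfl⟩

lemma exists_antidiag_mul_bruhat (hF : Nat.card F = 2 ^ (2 * m + 1))
    (x : Option (F × F) × F × F × Fˣ) : ∃ y, antidiag F * bruhat m x = bruhat m y := by
  obtain ⟨_ | v, c, e, κ⟩ := x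
  · exact ⟨⟨some (0, 0), c, e, κ⟩, by simp [bruhat, cosetRep, w_zero]⟩
  · by_cases hv : v.1 ≠ 0 ∨ v.2 ≠ 0
    · obtain ⟨a', b', c', e', l, h⟩ := antidiag_mul_w_mul_antidiag hF v.1 v.2 hv
      -- `antidiag F` is itself the representative of the point (0, 0), so after the commutation
      -- relation only left factors `w` and `d` remain to be absorbed.
      have : antidiag F * bruhat m (some v, c, e, κ) =
          w m a' b' * (d m l * bruhat m (some (0, 0), c' + c, e' + e + c' ^ 2 ^ (m + 1) * c, κ)) := by
        simp only [bruhat, cosetRep, w_zero, one_mul]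
        rw [← w_mul_w hF]
        calc _ = antidiag F * w m v.1 v.2 * antidiag F * (w m c e * d m κ) := by
              simp only [mul_assoc]
          _ = _ := by rw [h]; simp only [mul_assoc]
      obtain ⟨y, hy⟩ := exists_d_mul_bruhat hF l
        (some (0, 0), c' + c, e' + e + c' ^ 2 ^ (m + 1) * c, κ)
      rw [this, hy]
      exact exists_w_mul_bruhat hF _ _ _
    · push Not at hv
      refine ⟨⟨none, c, e, κ⟩, ?_⟩
      simp only [bruhat, cosetRep, hv.1, hv.2, w_zero, one_mul]
      rw [← mul_assoc, antidiag_mul_antidiag, one_mul]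

/-- The parametrized set contains 1 and is stable under left multiplication by the generators, whose
inverses are again generators. -/
lemma exists_eq_bruhat (hF : Nat.card F = 2 ^ (2 * m + 1)) {g : SL(4, F)} (hg : g ∈ Sz m F) :
    ∃ x, g = bruhat m x := by
  have hgen : ∀ x ∈ ({g | ∃ a b : F, g = w m a b} ∪ {g | ∃ κ : Fˣ, g = d m κ} ∪ {antidiag F} :
      Set SL(4, F)), ∀ y, ∃ z, x * bruhat m y = bruhat m z := by
    rintro x ((⟨a, b, rfl⟩ | ⟨κ, rfl⟩) | rfl) y
    · exact exists_w_mul_bruhat hF _ _ _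
    · exact exists_d_mul_bruhat hF _ _
    · exact exists_antidiag_mul_bruhat hF _
  have hinv : ∀ x ∈ ({g | ∃ a b : F, g = w m a b} ∪ {g | ∃ κ : Fˣ, g = d m κ} ∪ {antidiag F} :
      Set SL(4, F)), x⁻¹ ∈ ({g | ∃ a b : F, g = w m a b} ∪ {g | ∃ κ : Fˣ, g = d m κ} ∪ {antidiag F} :
      Set SL(4, F)) := by
    rintro x ((⟨a, b, rfl⟩ | ⟨κ, rfl⟩) | rfl)
    · exact Or.inl (Or.inl ⟨_, _, w_inv hF _ _⟩)
    · exact Or.inl (Or.inr ⟨_, inv_d _⟩)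
    · exact Or.inr inv_antidiag
  refine Subgroup.closure_induction_left (p := fun g _ => ∃ x, g = bruhat m x) ?_ ?_ ?_ hg
  · exact ⟨⟨none, 0, 0, 1⟩, by simp [bruhat, cosetRep, w_zero, d_one]⟩
  · rintro x hx y _ ⟨z, rfl⟩
    exact hgen x hx z
  · rintro x hx y _ ⟨z, rfl⟩
    exact hgen _ (hinv x hx) z

/-- An element of the Suzuki group whose upper right corner vanishes is lower triangular. -/
lemma exists_eq_w_mul_d (hF : Nat.card F = 2 ^ (2 * m + 1)) {g : SL(4, F)} (hg : g ∈ Sz m F)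
    (h0 : g 0 3 = 0) : ∃ a b κ, g = w m a b * d m κ := by
  obtain ⟨⟨_ | v, a, b, κ⟩, rfl⟩ := exists_eq_bruhat hF hg
  · exact ⟨a, b, κ, by simp [bruhat, cosetRep]⟩
  · exfalso
    simp only [bruhat, cosetRep, mul_assoc] at h0
    rw [Matrix.SpecialLinearGroup.coe_mul, Matrix.mul_apply] at h0
    simp only [antidiag_mul_apply, Fin.sum_univ_four, Matrix.SpecialLinearGroup.coe_mul, coe_w,
      coe_d, Matrix.mul_apply] at h0
    simp [Fin.rev] at h0

lemma card_Sz (hF : Nat.card F = 2 ^ (2 * m + 1)) :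
    Nat.card (Sz m F) = (Nat.card F ^ 2 + 1) * (Nat.card F ^ 2 * (Nat.card F - 1)) := by
  have := Fintype.ofFinite F
  have e : (Option (F × F) × F × F × Fˣ) ≃ Sz m F := by
    refine Equiv.ofBijective (fun x => ⟨bruhat m x, bruhat_mem_Sz x⟩) ⟨?_, ?_⟩
    · intro x y h
      exact bruhat_injective hF (congrArg Subtype.val h)
    · rintro ⟨g, hg⟩
      obtain ⟨x, rfl⟩ := exists_eq_bruhat hF hg
      exact ⟨x, rfl⟩
  rw [← Nat.card_congr e, Nat.card_prod, Nat.card_prod, Nat.card_prod, Finite.card_option,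
    Nat.card_prod, Nat.card_units]
  ring

end Bruhat

/-! ### Characteristic polynomials are determined by the trace -/

section Charpoly

open Polynomial

/-- The quartic that is the characteristic polynomial of the elements of trace `s` in the Suzuki
group. -/
noncomputable def quartic (m : ℕ) (s : F) : F[X] :=
  X ^ 4 + C s * X ^ 3 + C (s ^ 2 ^ (m + 1)) * X ^ 2 + C s * X + 1

lemma charpoly_mul_comm (g h : SL(4, F)) : (g * h).1.charpoly = (h * g).1.charpoly :=
  Matrix.charpoly_mul_comm _ _

lemma trace_mul_comm (g h : SL(4, F)) : (g * h).1.trace = (h * g).1.trace :=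
  Matrix.trace_mul_comm _ _

/-- The sum of the principal minors of size two of a `4 × 4` matrix. -/
def minorsTwo (N : Matrix (Fin 4) (Fin 4) F) : F :=
  (N 0 0 * N 1 1 - N 0 1 * N 1 0) +
    (N 0 0 * N 2 2 - N 0 2 * N 2 0) +
    (N 0 0 * N 3 3 - N 0 3 * N 3 0) +
    (N 1 1 * N 2 2 - N 1 2 * N 2 1) +
    (N 1 1 * N 3 3 - N 1 3 * N 3 1) +
    (N 2 2 * N 3 3 - N 2 3 * N 3 2)

/-- The sum of the principal minors of size three of a `4 × 4` matrix. -/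
def minorsThree (N : Matrix (Fin 4) (Fin 4) F) : F :=
  (N 0 0 * (N 1 1 * N 2 2
      - N 1 2 * N 2 1) - N 0 1 * (N 1 0 * N 2 2 - N 1 2 * N 2 0) + N 0 2 * (N 1 0 * N 2 1 - N 1 1 * N 2 0)) +
    (N 0 0 * (N 1 1 * N 3 3
      - N 1 3 * N 3 1) - N 0 1 * (N 1 0 * N 3 3 - N 1 3 * N 3 0) + N 0 3 * (N 1 0 * N 3 1 - N 1 1 * N 3 0)) +
    (N 0 0 * (N 2 2 * N 3 3
      - N 2 3 * N 3 2) - N 0 2 * (N 2 0 * N 3 3 - N 2 3 * N 3 0) + N 0 3 * (N 2 0 * N 3 2 - N 2 2 * N 3 0)) +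
    (N 1 1 * (N 2 2 * N 3 3
      - N 2 3 * N 3 2) - N 1 2 * (N 2 1 * N 3 3 - N 2 3 * N 3 1) + N 1 3 * (N 2 1 * N 3 2 - N 2 2 * N 3 1))

lemma charpoly_fin_four (N : Matrix (Fin 4) (Fin 4) F) :
    N.charpoly = X ^ 4 - C N.trace * X ^ 3 + C (minorsTwo N) * X ^ 2 - C (minorsThree N) * X +
      C N.det := by
  rw [Matrix.charpoly, minorsTwo, minorsThree]
  simp only [Matrix.det_succ_row_zero, Fin.sum_univ_succ, Matrix.trace]
  simp [Matrix.charmatrix, Fin.succAbove]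
  ring

variable [CharP F 2]

lemma charpoly_eq_quartic {g : SL(4, F)} (h2 : minorsTwo g.1 = g.1.trace ^ 2 ^ (m + 1))
    (h3 : minorsThree g.1 = g.1.trace) : g.1.charpoly = quartic m g.1.trace := by
  rw [charpoly_fin_four, h2, h3, g.2, quartic, CharTwo.sub_eq_add, CharTwo.sub_eq_add, C_1]

variable [Finite F]

lemma charpoly_w_mul_d (hF : Nat.card F = 2 ^ (2 * m + 1)) (a b : F) (κ : Fˣ) :
    (w m a b * d m κ : SL(4, F)).1.charpoly =
      quartic m (Matrix.trace (w m a b * d m κ : SL(4, F)).1) := by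
  have hk := twist_twist hF (κ : F)
  have h0 : (κ : F) ≠ 0 := κ.ne_zero
  have h1 : (κ : F) ^ 2 ^ (m + 1) ≠ 0 := pow_ne_zero _ h0
  apply charpoly_eq_quartic <;>
  · rw [Matrix.SpecialLinearGroup.coe_mul, coe_w, coe_d]
    simp [minorsTwo, minorsThree, Matrix.mul_apply, Fin.sum_univ_four, Matrix.trace, twist_add,
      mul_pow, hk, inv_pow]
    clear hk
    generalize (κ : F) ^ 2 ^ (m + 1) = k at *
    field_simp
    try grind

lemma charpoly_w_mul_d_mul_antidiag (hF : Nat.card F = 2 ^ (2 * m + 1)) (a b : F) (κ : Fˣ) :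
    (w m a b * d m κ * antidiag F : SL(4, F)).1.charpoly =
      quartic m (Matrix.trace (w m a b * d m κ * antidiag F : SL(4, F)).1) := by
  have hk := twist_twist hF (κ : F)
  have hA := twist_twist hF a
  have hB := twist_twist hF b
  have h0 : (κ : F) ≠ 0 := κ.ne_zero
  have h1 : (κ : F) ^ 2 ^ (m + 1) ≠ 0 := pow_ne_zero _ h0
  apply charpoly_eq_quartic <;>
  · rw [Matrix.SpecialLinearGroup.coe_mul, Matrix.SpecialLinearGroup.coe_mul, coe_w, coe_d,
      coe_antidiag]
    simp [minorsTwo, minorsThree, Matrix.mul_apply, Fin.sum_univ_four, Matrix.trace, twist_add,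
      mul_pow, hk, hA, hB, pow_right_comm _ 2]
    clear hk hA hB
    generalize (κ : F) ^ 2 ^ (m + 1) = k at *
    generalize a ^ 2 ^ (m + 1) = A at *
    generalize b ^ 2 ^ (m + 1) = B at *
    field_simp
    try grind

/-- Trace and characteristic polynomial are invariant under cyclic shifts of a product. An element
of the big cell can thus be brought to the form w·d·`antidiag`, and two explicit families of
matrices remain. -/
lemma charpoly_of_mem_Sz (hF : Nat.card F = 2 ^ (2 * m + 1)) {g : SL(4, F)} (hg : g ∈ Sz m F) :
    g.1.charpoly = quartic m g.1.trace := by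
  obtain ⟨⟨_ | v, a, b, κ⟩, rfl⟩ := exists_eq_bruhat hF hg
  · simp only [bruhat, cosetRep, one_mul]
    exact charpoly_w_mul_d hF a b κ
  · have h : w m a b * d m κ * (w m v.1 v.2 * antidiag F) = w m a b * (d m κ * w m v.1 v.2) *
        antidiag F := by simp only [mul_assoc]
    rw [d_mul_w hF, ← mul_assoc (w m a b) (w m _ _), w_mul_w hF] at h
    simp only [bruhat, cosetRep]
    rw [charpoly_mul_comm, trace_mul_comm, h]
    exact charpoly_w_mul_d_mul_antidiag hF _ _ _

/-- The trace of w(0, b)·`antidiag` is b^t, and the twist is surjective. -/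
lemma exists_trace_eq (hF : Nat.card F = 2 ^ (2 * m + 1)) (s : F) :
    ∃ g ∈ Sz m F, g.1.trace = s := by
  obtain ⟨b, hb⟩ := twist_surjective hF s
  refine ⟨w m 0 b * antidiag F, mul_mem (w_mem_Sz _ _) antidiag_mem_Sz, ?_⟩
  simp only [Matrix.trace, Matrix.diag, mul_antidiag_apply, Fin.sum_univ_four, coe_w]
  simp [Fin.rev, hb]

end Charpoly

end Suzuki

namespace Suzuki

variable {F : Type*} [Field F] {m : ℕ}

/-! ### Roots of the quartics and the three tori -/

section Roots

variable {K : Type*} [Field K] [CharP K 2]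

omit [CharP K 2] in
lemma eq_or_mul_eq_one_of_add_inv_eq {a b : K} (ha : a ≠ 0) (hb : b ≠ 0)
    (h : a + a⁻¹ = b + b⁻¹) : a = b ∨ a * b = 1 := by
  have h1 : (a - b) * (a * b - 1) = 0 := by
    field_simp at h
    linear_combination h
  rcases mul_eq_zero.1 h1 with h2 | h2
  · exact Or.inl (sub_eq_zero.1 h2)
  · exact Or.inr (sub_eq_zero.1 h2)

lemma sq_injective {x y : K} (h : x ^ 2 = y ^ 2) : x = y := by
  have : (x - y) ^ 2 = 0 := by rw [sub_pow_char, h, sub_self]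
  exact sub_eq_zero.1 (pow_eq_zero_iff two_ne_zero |>.1 this)

omit [CharP K 2] in
lemma pow_twist_twist (m : ℕ) (x : K) :
    (x ^ 2 ^ (m + 1)) ^ 2 ^ (m + 1) = (x ^ 2 ^ (2 * m + 1)) ^ 2 := by
  rw [← pow_mul, ← pow_mul]; congr 1; ring

/-- The hypotheses say x^t = (xμ)^(±1) and μ^t = (x/μ)^(±1). Computing x^(t²) = (x^q)² and taking
the unique square root gives x^q = x when the signs agree and x^q = μ when they differ. -/
lemma torus_of_add_inv_eq {x μ : K} (hx : x ≠ 0) (hμ : μ ≠ 0)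
    (h1 : x ^ 2 ^ (m + 1) + (x ^ 2 ^ (m + 1))⁻¹ = x * μ + (x * μ)⁻¹)
    (h2 : μ ^ 2 ^ (m + 1) + (μ ^ 2 ^ (m + 1))⁻¹ = x / μ + (x / μ)⁻¹) :
    x ^ 2 ^ (2 * m + 1) = x ∨ x ^ 2 ^ (2 * m + 1) * x ^ 2 ^ (m + 1) * x = 1 ∨
      x ^ 2 ^ (2 * m + 1) * x = x ^ 2 ^ (m + 1) := by
  have hu0 : x ^ 2 ^ (m + 1) ≠ 0 := pow_ne_zero _ hx
  have hv0 : μ ^ 2 ^ (m + 1) ≠ 0 := pow_ne_zero _ hμ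
  have hq := pow_twist_twist m x
  rcases eq_or_mul_eq_one_of_add_inv_eq hu0 (mul_ne_zero hx hμ) h1 with h3 | h3 <;>
  rcases eq_or_mul_eq_one_of_add_inv_eq hv0 (div_ne_zero hx hμ) h2 with h4 | h4
  · left
    apply sq_injective
    rw [← hq, h3, mul_pow, h3, h4]
    field_simp
  · right; right
    have : x ^ 2 ^ (2 * m + 1) = μ := by
      apply sq_injective
      rw [← hq, h3, mul_pow, h3]
      field_simp at h4
      linear_combination μ * h4
    rw [this, h3, mul_comm]
  · right; left
    have : x ^ 2 ^ (2 * m + 1) = μ := by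
      apply sq_injective
      have h5 := congrArg (· ^ 2 ^ (m + 1)) h3
      simp only [mul_pow, hq, one_pow, h4] at h5
      field_simp at h5
      have h6 : x ^ 2 ^ (m + 1) * x ≠ 0 := mul_ne_zero hu0 hx
      apply mul_right_cancel₀ h6
      linear_combination h5 - μ * h3
    rw [this]
    linear_combination h3
  · left
    apply sq_injective
    have h5 := congrArg (· ^ 2 ^ (m + 1)) h3
    simp only [mul_pow, hq, one_pow] at h5
    have h6 : x ^ 2 ^ (m + 1) * μ ^ 2 ^ (m + 1) * x ^ 2 = 1 := by
      field_simp at h4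
      calc _ = (x ^ 2 ^ (m + 1) * x) * (μ ^ 2 ^ (m + 1) * x) := by ring
        _ = (x ^ 2 ^ (m + 1) * x) * μ := by rw [h4]
        _ = 1 := by linear_combination h3
    apply mul_right_cancel₀ (mul_ne_zero hu0 hv0)
    linear_combination h5 - h6

/-- The roots of the characteristic polynomials lie in one of three tori. -/
lemma torus_of_root [IsAlgClosed K] {x s : K}
    (hs : (s ^ 2 ^ (m + 1)) ^ 2 ^ (m + 1) = s ^ 2)
    (hx : x ^ 4 + s * x ^ 3 + s ^ 2 ^ (m + 1) * x ^ 2 + s * x + 1 = 0) :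
    x ^ 2 ^ (2 * m + 1) = x ∨ x ^ 2 ^ (2 * m + 1) * x ^ 2 ^ (m + 1) * x = 1 ∨
      x ^ 2 ^ (2 * m + 1) * x = x ^ 2 ^ (m + 1) := by
  have hx0 : x ≠ 0 := by rintro rfl; simp at hx
  -- The quartic is palindromic: besides x and x⁻¹ its roots are μ and μ⁻¹, where μ + μ⁻¹ = s + x +
  -- x⁻¹ in characteristic 2.
  obtain ⟨μ, hμ⟩ : ∃ μ : K, μ ^ 2 + (s + x + x⁻¹) * μ + 1 = 0 := by
    have hdeg : (Polynomial.X ^ 2 + Polynomial.C (s + x + x⁻¹) * Polynomial.X + 1 :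
        Polynomial K).degree = 2 := by compute_degree!
    obtain ⟨μ, h⟩ := IsAlgClosed.exists_root _ (hdeg.trans_ne two_ne_zero)
    exact ⟨μ, by simpa [Polynomial.IsRoot] using h⟩
  have hμ0 : μ ≠ 0 := by rintro rfl; simp at hμ
  have hS : s = x + x⁻¹ + (μ + μ⁻¹) := by
    field_simp at hμ ⊢
    grind
  have hT : s ^ 2 ^ (m + 1) = (x + x⁻¹) * (μ + μ⁻¹) := by
    have : s ^ 2 ^ (m + 1) = x ^ 2 + (x⁻¹) ^ 2 + s * (x + x⁻¹) := by
      generalize s ^ 2 ^ (m + 1) = T at *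
      clear hS hs hμ
      field_simp
      grind
    rw [this, hS]
    grind
  have hTT : (s ^ 2 ^ (m + 1)) ^ 2 ^ (m + 1) =
      (x ^ 2 ^ (m + 1) + (x ^ 2 ^ (m + 1))⁻¹) * (μ ^ 2 ^ (m + 1) + (μ ^ 2 ^ (m + 1))⁻¹) := by
    rw [hT, mul_pow, twist_add, twist_add, inv_pow, inv_pow]
  have hT2 : s ^ 2 ^ (m + 1) =
      (x ^ 2 ^ (m + 1) + (x ^ 2 ^ (m + 1))⁻¹) + (μ ^ 2 ^ (m + 1) + (μ ^ 2 ^ (m + 1))⁻¹) := by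
    rw [hS, twist_add, twist_add, twist_add, inv_pow, inv_pow]
  rw [hs] at hTT
  have hu0 : x ^ 2 ^ (m + 1) ≠ 0 := pow_ne_zero _ hx0
  have hv0 : μ ^ 2 ^ (m + 1) ≠ 0 := pow_ne_zero _ hμ0
  -- The pairs {x^t + x^(-t), μ^t + μ^(-t)} and {xμ + (xμ)⁻¹, x/μ + μ/x} have the same sum s^t and
  -- the same product s², hence coincide. Replacing μ by μ⁻¹ exchanges the two matchings.
  have hcase : (x ^ 2 ^ (m + 1) + (x ^ 2 ^ (m + 1))⁻¹ = x * μ + (x * μ)⁻¹ ∧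
      μ ^ 2 ^ (m + 1) + (μ ^ 2 ^ (m + 1))⁻¹ = x / μ + (x / μ)⁻¹) ∨
      (x ^ 2 ^ (m + 1) + (x ^ 2 ^ (m + 1))⁻¹ = x * μ⁻¹ + (x * μ⁻¹)⁻¹ ∧
      μ ^ 2 ^ (m + 1) + (μ ^ 2 ^ (m + 1))⁻¹ = x / μ⁻¹ + (x / μ⁻¹)⁻¹) := by
    rw [hS] at hTT
    rw [hT] at hT2
    clear hT hS hs hμ hx
    generalize x ^ 2 ^ (m + 1) + (x ^ 2 ^ (m + 1))⁻¹ = U at *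
    generalize μ ^ 2 ^ (m + 1) + (μ ^ 2 ^ (m + 1))⁻¹ = V at *
    have hxi : x * x⁻¹ = 1 := mul_inv_cancel₀ hx0
    have hμi : μ * μ⁻¹ = 1 := mul_inv_cancel₀ hμ0
    rw [div_eq_mul_inv, div_eq_mul_inv, inv_inv, mul_inv, mul_inv, inv_inv]
    generalize x⁻¹ = x' at *
    generalize μ⁻¹ = μ' at *
    have h0 : (U - (x * μ + x' * μ')) * (U - (x * μ' + x' * μ)) = 0 := by
      clear hx0 hμ0 hu0 hv0
      grind
    rcases mul_eq_zero.1 h0 with h | h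
    · left; constructor <;> grind
    · right; constructor <;> grind
  rcases hcase with ⟨h1, h2⟩ | ⟨h1, h2⟩
  · exact torus_of_add_inv_eq hx0 hμ0 h1 h2
  · refine torus_of_add_inv_eq hx0 (inv_ne_zero hμ0) h1 ?_
    rw [← h2, inv_pow, inv_inv, add_comm]

/-- The trace of a torus element with eigenvalues `x`, `x ^ q`, `x⁻¹`, `(x ^ q)⁻¹` satisfies the
quartic. -/
lemma root_of_torus {x y : K} (hx : x ≠ 0) (hy : y = x ^ 2 ^ (2 * m + 1))
    (hyy : y ^ 2 ^ (2 * m + 1) = x⁻¹)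
    (h : y * x ^ 2 ^ (m + 1) * x = 1 ∨ y * x = x ^ 2 ^ (m + 1)) :
    x ^ 4 + (x + y + x⁻¹ + y⁻¹) * x ^ 3 + (x + y + x⁻¹ + y⁻¹) ^ 2 ^ (m + 1) * x ^ 2 +
      (x + y + x⁻¹ + y⁻¹) * x + 1 = 0 := by
  have hy0 : y ≠ 0 := by rw [hy]; exact pow_ne_zero _ hx
  have hv : y ^ 2 ^ (m + 1) = (x ^ 2 ^ (m + 1)) ^ 2 ^ (2 * m + 1) := by
    rw [hy, pow_right_comm]
  -- The torus relation says x^t = (xy)^(±1); raising it to the power q gives y^t = (y/x)^(±1). The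
  -- twisted trace is thereby the middle coefficient of the quartic with roots x, y, x⁻¹, y⁻¹.
  have key : (x + y + x⁻¹ + y⁻¹) ^ 2 ^ (m + 1) = (x + x⁻¹) * (y + y⁻¹) := by
    simp only [twist_add, inv_pow]
    rcases h with h | h
    · have hu : x ^ 2 ^ (m + 1) = (x * y)⁻¹ := by
        field_simp; linear_combination h
      rw [hv, hu, inv_pow, mul_pow, ← hy, hyy]
      field_simp; ring
    · rw [hv, ← h, mul_pow, ← hy, hyy]
      field_simp; ring
  rw [key]
  field_simp
  grind

end Roots

/-! ### Eigenvectors over an extension field and their conjugates -/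

section Eigenvectors

open scoped Matrix

/-- X^q - X has at most q roots in K, and the image of F already supplies q of them. -/
lemma exists_algebraMap_eq {K : Type*} [Field K] [Algebra F K] [Finite F] {s : K}
    (hs : s ^ Nat.card F = s) : ∃ a : F, algebraMap F K a = s := by
  classical
  have := Fintype.ofFinite F
  rw [Nat.card_eq_fintype_card] at hs
  have hne : (Polynomial.X ^ Fintype.card F - Polynomial.X : Polynomial K) ≠ 0 :=
    FiniteField.X_pow_card_sub_X_ne_zero K Fintype.one_lt_card
  have heq : Finset.univ.image (algebraMap F K) =
      (Polynomial.X ^ Fintype.card F - Polynomial.X : Polynomial K).roots.toFinset := by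
    apply Finset.eq_of_subset_of_card_le
    · intro x hx
      obtain ⟨a, -, rfl⟩ := Finset.mem_image.1 hx
      simp [hne, ← map_pow, FiniteField.pow_card]
    · rw [Finset.card_image_of_injective _ (algebraMap F K).injective, Finset.card_univ]
      refine (Multiset.toFinset_card_le _).trans ((Polynomial.card_roots' _).trans ?_)
      rw [FiniteField.X_pow_card_sub_X_natDegree_eq K Fintype.one_lt_card]
  have : s ∈ Finset.univ.image (algebraMap F K) := by
    rw [heq]
    simp [hne, hs]
  obtain ⟨a, -, h⟩ := Finset.mem_image.1 this
  exact ⟨a, h⟩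

variable {K : Type*} [Field K] [Algebra F K]

lemma map_mulVec_comp {n : Type*} [Fintype n] (φ : K →ₐ[F] K) (M : Matrix n n F) (v : n → K) :
    M.map (algebraMap F K) *ᵥ (φ ∘ v) = φ ∘ (M.map (algebraMap F K) *ᵥ v) := by
  ext i
  simp [Matrix.mulVec, dotProduct]

section Conjugates

variable {n : Type*} [Fintype n] [DecidableEq n] {φ : n → K →ₐ[F] K} {x : K} {v : n → K}
  {g : Matrix n n F}

/-- The conjugates of an eigenvector whose eigenvalue has distinct conjugates. -/
lemma linearIndependent_conjugates (hφ : Function.Injective fun j => φ j x) (hv : v ≠ 0)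
    (hg : g.map (algebraMap F K) *ᵥ v = x • v) : LinearIndependent K fun j => φ j ∘ v := by
  refine Module.End.eigenvectors_linearIndependent'
    (Matrix.toLin' (g.map (algebraMap F K))) (fun j => φ j x) hφ _ fun j => ⟨?_, ?_⟩
  · rw [Module.End.mem_eigenspace_iff, Matrix.toLin'_apply, map_mulVec_comp, hg]
    ext i
    simp
  · intro h
    apply hv
    ext i
    have := congrFun h i
    simpa using this

/-- A matrix over F that kills v kills all its conjugates, which form a basis. So a matrix over F is
determined by its value at v. -/
lemma eq_zero_of_map_mulVec_eq_zero [Nonempty n] (hφ : Function.Injective fun j => φ j x)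
    (hv : v ≠ 0) (hg : g.map (algebraMap F K) *ᵥ v = x • v) {M : Matrix n n F}
    (hM : M.map (algebraMap F K) *ᵥ v = 0) : M = 0 := by
  have hli := linearIndependent_conjugates hφ hv hg
  let b := basisOfLinearIndependentOfCardEqFinrank hli (by simp)
  have h0 : Matrix.toLin' (M.map (algebraMap F K)) = 0 := by
    refine b.ext fun j => ?_
    simp only [b, coe_basisOfLinearIndependentOfCardEqFinrank, Matrix.toLin'_apply,
      map_mulVec_comp, hM]
    ext i
    simp
  have h1 : M.map (algebraMap F K) = 0 := by simpa using h0
  ext i j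
  have := congrFun (congrFun h1 i) j
  simpa using this

/-- The conjugates of v are an eigenbasis with distinct eigenvalues, so the x-eigenspace of g is the
line through v; a commuting matrix preserves it. -/
lemma exists_smul_of_commute [Nonempty n] (hφ : Function.Injective fun j => φ j x) {j₀ : n}
    (hj₀ : φ j₀ = AlgHom.id F K)
    (hv : v ≠ 0) (hg : g.map (algebraMap F K) *ᵥ v = x • v) {h : Matrix n n F}
    (hh : g * h = h * g) : ∃ c : K, h.map (algebraMap F K) *ᵥ v = c • v := by
  have hli := linearIndependent_conjugates hφ hv hg
  let b := basisOfLinearIndependentOfCardEqFinrank hli (by simp)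
  have hb (j) : b j = φ j ∘ v := by simp [b]
  set u := h.map (algebraMap F K) *ᵥ v with hu
  have hsum := b.sum_repr u
  have hgu : g.map (algebraMap F K) *ᵥ u = x • u := by
    rw [hu, Matrix.mulVec_mulVec, ← Matrix.map_mul, hh, Matrix.map_mul, ← Matrix.mulVec_mulVec,
      hg, Matrix.mulVec_smul]
  have hgb (j) : g.map (algebraMap F K) *ᵥ b j = φ j x • b j := by
    rw [hb, map_mulVec_comp, hg]
    ext i
    simp
  have hzero : ∑ j, (b.repr u j * (φ j x - x)) • b j = 0 := by
    have h1 : g.map (algebraMap F K) *ᵥ (∑ j, b.repr u j • b j) = x • ∑ j, b.repr u j • b j := by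
      rw [hsum, hgu]
    rw [Matrix.mulVec_sum, Finset.smul_sum] at h1
    simp only [Matrix.mulVec_smul, hgb] at h1
    rw [← sub_eq_zero, ← Finset.sum_sub_distrib] at h1
    rw [← h1]
    refine Finset.sum_congr rfl fun j _ => ?_
    rw [smul_smul, smul_smul, ← sub_smul]
    congr 1
    ring
  have hcoef := Fintype.linearIndependent_iff.1 b.linearIndependent _ hzero
  refine ⟨b.repr u j₀, ?_⟩
  conv_lhs => rw [← hsum]
  rw [Finset.sum_eq_single j₀]
  · rw [hb, hj₀]
    rfl
  · intro j _ hj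
    have hne : φ j x - x ≠ 0 := by
      rw [sub_ne_zero]
      intro h
      apply hj
      apply hφ
      simp [h, hj₀]
    rw [(mul_eq_zero.1 (hcoef j)).resolve_right hne, zero_smul]
  · simp

end Conjugates

lemma exists_eigenvector_iff {n : Type*} [Fintype n] [DecidableEq n] (g : Matrix n n F) (c : K) :
    (∃ v : n → K, v ≠ 0 ∧ g.map (algebraMap F K) *ᵥ v = c • v) ↔
      g.charpoly.aeval c = 0 := by
  have h := Module.End.hasEigenvalue_iff_isRoot_charpoly
    (Matrix.toLin' (g.map (algebraMap F K))) c
  rw [Matrix.charpoly_toLin', show (g.map (algebraMap F K)).charpoly =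
    g.charpoly.map (algebraMap F K) from Matrix.charpoly_map g (algebraMap F K)] at h
  rw [Polynomial.aeval_def, ← Polynomial.eval_map]
  refine Iff.trans ⟨?_, ?_⟩ h
  · rintro ⟨v, hv, hgv⟩
    exact Module.End.hasEigenvalue_of_hasEigenvector (x := v)
      ⟨by rw [Module.End.mem_eigenspace_iff, Matrix.toLin'_apply, hgv], hv⟩
  · intro hc
    obtain ⟨v, hv⟩ := hc.exists_hasEigenvector
    refine ⟨v, hv.2, ?_⟩
    have := hv.1
    rwa [Module.End.mem_eigenspace_iff, Matrix.toLin'_apply] at this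

lemma aeval_quartic (s : F) (c : K) : (quartic m s).aeval c =
    c ^ 4 + algebraMap F K s * c ^ 3 + (algebraMap F K s) ^ 2 ^ (m + 1) * c ^ 2 +
      algebraMap F K s * c + 1 := by
  simp [quartic]

end Eigenvectors

end Suzuki

/-- Counting conjugates of a family of elements of order `n`. -/
lemma card_mul_card_le_mul_numOrder {G ι : Type*} [Group G] [Finite G] [Fintype ι] {n k c : ℕ}
    (γ : ι → G) (hγ : ∀ i, orderOf (γ i) = n)
    (hk : ∀ i, Nat.card {j // IsConj (γ i) (γ j)} ≤ k)
    (hc : ∀ i, Nat.card (Subgroup.centralizer {γ i}) ≤ c) :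
    Fintype.card ι * Nat.card G ≤ c * k * numOrder G n := by
  classical
  have := Fintype.ofFinite G
  have hfib (i : ι) (y : G) : (Finset.univ.filter fun x : G => x * γ i * x⁻¹ = y).card ≤ c := by
    rcases (Finset.univ.filter fun x : G => x * γ i * x⁻¹ = y).eq_empty_or_nonempty with h | ⟨x₀, h⟩
    · simp [h]
    · have hx₀ := (Finset.mem_filter.1 h).2
      refine le_trans ?_ (hc i)
      rw [← Fintype.card_subtype, ← Nat.card_eq_fintype_card]
      refine Nat.card_le_card_of_injective (fun x : {x // x * γ i * x⁻¹ = y} => ⟨x₀⁻¹ * x, ?_⟩) fun x x' h =>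
        Subtype.ext (mul_left_cancel (congrArg Subtype.val h))
      rw [Subgroup.mem_centralizer_singleton_iff]
      have h1 : x.1 * γ i * x.1⁻¹ = x₀ * γ i * x₀⁻¹ := x.2.trans hx₀.symm
      calc x₀⁻¹ * x * γ i = x₀⁻¹ * (x.1 * γ i * x.1⁻¹) * x := by group
        _ = γ i * (x₀⁻¹ * x) := by rw [h1]; group
  -- Double counting with (i, x) ↦ x·γ i·x⁻¹: a fibre meets at most k indices i, and for each of
  -- them the possible x lie in one coset of the centralizer.
  let Φ : ι × G → {g : G // orderOf g = n} := fun p => ⟨p.2 * γ p.1 * p.2⁻¹, by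
    rw [← hγ p.1, ← MulAut.conj_apply]; exact MulEquiv.orderOf_eq _ _⟩
  have hΦ (y) : (Finset.univ.filter fun p => Φ p = y).card ≤ c * k := by
    set S := Finset.univ.filter fun p => Φ p = y with hS
    rcases S.eq_empty_or_nonempty with h | ⟨⟨i₀, x₀⟩, h⟩
    · simp [h]
    have h₀ : x₀ * γ i₀ * x₀⁻¹ = y := congrArg Subtype.val (Finset.mem_filter.1 h).2
    have h1 : S.card ≤ c * (Finset.univ.filter fun j => IsConj (γ i₀) (γ j)).card := by
      refine Finset.card_le_mul_card_image_of_maps_to (f := Prod.fst) ?_ c ?_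
      · rintro ⟨i, x⟩ hx
        have hx' : x * γ i * x⁻¹ = y := congrArg Subtype.val (Finset.mem_filter.1 hx).2
        refine Finset.mem_filter.2 ⟨Finset.mem_univ _, ?_⟩
        exact (isConj_iff.2 ⟨x₀, h₀⟩ : IsConj (γ i₀) y).trans
          (isConj_iff.2 ⟨x, hx'⟩ : IsConj (γ i) y).symm
      · intro i _
        refine le_trans (Finset.card_le_card_of_injOn Prod.snd ?_ ?_) (hfib i y)
        · rintro ⟨j, x⟩ hx
          obtain ⟨hS, rfl⟩ := Finset.mem_filter.1 hx
          have hy : Φ (j, x) = y := (Finset.mem_filter.1 hS).2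
          rw [← hy]
          simp [Φ]
        · rintro ⟨j, x⟩ hx ⟨j', x'⟩ hx' h
          obtain ⟨-, rfl⟩ := Finset.mem_filter.1 hx
          obtain ⟨-, rfl⟩ := Finset.mem_filter.1 hx'
          exact Prod.ext rfl h
    refine h1.trans (Nat.mul_le_mul_left _ ?_)
    rw [← Fintype.card_subtype, ← Nat.card_eq_fintype_card]
    exact hk i₀
  have := Finset.card_le_mul_card_image_of_maps_to (f := Φ) (s := Finset.univ) (t := Finset.univ)
    (fun _ _ => Finset.mem_univ _) (c * k) fun y _ => hΦ y
  rwa [Finset.card_univ, Finset.card_univ, Fintype.card_prod, ← Nat.card_eq_fintype_card (α := G),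
    ← Nat.card_eq_fintype_card (α := {g : G // orderOf g = n})] at this

namespace Suzuki

variable {F : Type*} [Field F] {m : ℕ}

/-! ### Elements of the anisotropic tori and their centralizers -/

section Anisotropic

open scoped Matrix

variable {K : Type*} [Field K] [Algebra F K]

lemma frobeniusAlgHom_pow_apply [Fintype F] (x : K) (j : ℕ) :
    ((FiniteField.frobeniusAlgHom F K) ^ j) x = x ^ Nat.card F ^ j := by
  rw [Nat.card_eq_fintype_card]
  induction j with
  | zero => simp
  | succ j ih => rw [pow_succ', AlgHom.mul_apply, ih]; simp [← pow_mul, pow_succ]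

/-- If `x ^ q ^ 2 = x⁻¹` then the four conjugates of `x` are distinct. -/
lemma injective_frobenius_pow_apply [Fintype F] [CharP K 2] {x : K} (hx1 : x ≠ 1) (hx0 : x ≠ 0)
    (hxx : (x ^ Nat.card F) ^ Nat.card F = x⁻¹) : Function.Injective fun j : Fin 4 =>
      ((FiniteField.frobeniusAlgHom F K) ^ (j : ℕ)) x := by
  set y := x ^ Nat.card F with hy
  have hy0 : y ≠ 0 := pow_ne_zero _ hx0
  have h0 : x ≠ x⁻¹ := fun h => by
    have h2 : x ^ 2 = 1 ^ 2 := by rw [sq, one_pow]; nth_rw 2 [h]; exact mul_inv_cancel₀ hx0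
    exact hx1 (sq_injective h2)
  have h1 : x ≠ y := fun h => by
    have h2 := hxx
    rw [← h, ← hy, ← h] at h2
    exact h0 h2
  have h2 : x⁻¹ ≠ y := fun h => by
    have h3 := hxx
    rw [← h, inv_pow, ← hy, ← h, inv_inv] at h3
    exact h0 h3
  have h3 : y ≠ y⁻¹ := fun h => by
    have h4 := congrArg (· ^ Nat.card F) h
    simp only [inv_pow, hxx, inv_inv] at h4
    exact h0 h4.symm
  have hval (j : Fin 4) : ((FiniteField.frobeniusAlgHom F K) ^ (j : ℕ)) x = ![x, y, x⁻¹, y⁻¹] j := by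
    rw [frobeniusAlgHom_pow_apply]
    fin_cases j
    · simp
    · simp [hy]
    · simp [← hxx, hy, ← pow_mul, sq]
    · have : x ^ Nat.card F ^ 3 = y⁻¹ := by
        rw [pow_succ, pow_mul, sq, pow_mul, ← hy, hxx, inv_pow]
      simpa using this
  intro i j hij
  simp only [hval] at hij
  have h4 : y⁻¹ ≠ x := fun h => h2 (by rw [← h, inv_inv])
  have h5 : x⁻¹ ≠ y⁻¹ := fun h => h1 (inv_injective h)
  fin_cases i <;> fin_cases j <;> first
    | rfl
    | exact absurd hij h0 | exact absurd hij.symm h0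
    | exact absurd hij h1 | exact absurd hij.symm h1
    | exact absurd hij h2 | exact absurd hij.symm h2
    | exact absurd hij h3 | exact absurd hij.symm h3
    | exact absurd hij h4 | exact absurd hij.symm h4
    | exact absurd hij h5 | exact absurd hij.symm h5

omit [Algebra F K]

/-- (q+1)² - t² = q² + 1 because t² = 2q. The two factors differ by 2t, a power of 2, so no root of
unity other than 1 in characteristic 2 has order dividing both. -/
lemma exists_complementary_torus {n : ℕ}
    (hn : n = 2 ^ (2 * m + 1) + 2 ^ (m + 1) + 1 ∨ n + 2 ^ (m + 1) = 2 ^ (2 * m + 1) + 1) :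
    ∃ n', n * n' = (2 ^ (2 * m + 1)) ^ 2 + 1 ∧ (n = n' + 2 ^ (m + 2) ∨ n' = n + 2 ^ (m + 2)) ∧
      (n' = 2 ^ (2 * m + 1) + 2 ^ (m + 1) + 1 ∨ n' + 2 ^ (m + 1) = 2 ^ (2 * m + 1) + 1) := by
  have hle : 2 ^ (m + 1) ≤ 2 ^ (2 * m + 1) := Nat.pow_le_pow_right (by norm_num) (by omega)
  have ht : (2 ^ (m + 1)) ^ 2 = 2 * 2 ^ (2 * m + 1) := by ring
  have ht2 : 2 ^ (m + 2) = 2 * 2 ^ (m + 1) := by ring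
  rw [ht2]
  generalize 2 ^ (m + 1) = t at *
  generalize 2 ^ (2 * m + 1) = q at *
  obtain ⟨k, rfl⟩ := Nat.exists_eq_add_of_le hle
  rcases hn with hn | hn
  · refine ⟨k + 1, ?_, Or.inl (by omega), Or.inr (by omega)⟩
    subst hn
    nlinarith
  · obtain rfl : n = k + 1 := by omega
    refine ⟨k + t + t + 1, by nlinarith, Or.inr (by omega), Or.inl (by omega)⟩

lemma pow_pow_eq_inv_of_torus {x : K} {n : ℕ}
    (hn : n = 2 ^ (2 * m + 1) + 2 ^ (m + 1) + 1 ∨ n + 2 ^ (m + 1) = 2 ^ (2 * m + 1) + 1)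
    (hx : x ^ n = 1) : (x ^ 2 ^ (2 * m + 1)) ^ 2 ^ (2 * m + 1) = x⁻¹ := by
  obtain ⟨n', h, -⟩ := exists_complementary_torus hn
  apply eq_inv_of_mul_eq_one_left
  rw [← pow_mul, ← pow_succ, ← sq, ← h, pow_mul, hx, one_pow]

lemma torus_eq_of_pow_eq_one {x : K} {n : ℕ}
    (hn : n = 2 ^ (2 * m + 1) + 2 ^ (m + 1) + 1 ∨ n + 2 ^ (m + 1) = 2 ^ (2 * m + 1) + 1)
    (hx : x ^ n = 1) : x ^ 2 ^ (2 * m + 1) * x ^ 2 ^ (m + 1) * x = 1 ∨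
      x ^ 2 ^ (2 * m + 1) * x = x ^ 2 ^ (m + 1) := by
  rcases hn with rfl | hn
  · left
    rwa [pow_succ, pow_add] at hx
  · right
    rw [← pow_succ, ← hn, pow_add, hx, one_mul]

/-- Every root of a characteristic polynomial lies in the field, in a given anisotropic torus or
in the complementary one. -/
lemma pow_eq_one_of_torus_eq {x : K} (hx : x ≠ 0) {n n' : ℕ}
    (hn : n = 2 ^ (2 * m + 1) + 2 ^ (m + 1) + 1 ∨ n + 2 ^ (m + 1) = 2 ^ (2 * m + 1) + 1)
    (hn' : n' = 2 ^ (2 * m + 1) + 2 ^ (m + 1) + 1 ∨ n' + 2 ^ (m + 1) = 2 ^ (2 * m + 1) + 1)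
    (hne : n ≠ n') (h : x ^ 2 ^ (2 * m + 1) = x ∨ x ^ 2 ^ (2 * m + 1) * x ^ 2 ^ (m + 1) * x = 1 ∨
      x ^ 2 ^ (2 * m + 1) * x = x ^ 2 ^ (m + 1)) :
    x ^ 2 ^ (2 * m + 1) = x ∨ x ^ n = 1 ∨ x ^ n' = 1 := by
  have h1 (k) (hk : k = 2 ^ (2 * m + 1) + 2 ^ (m + 1) + 1)
      (h : x ^ 2 ^ (2 * m + 1) * x ^ 2 ^ (m + 1) * x = 1) : x ^ k = 1 := by
    rw [hk, pow_succ, pow_add, h]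
  have h2 (k) (hk : k + 2 ^ (m + 1) = 2 ^ (2 * m + 1) + 1)
      (h : x ^ 2 ^ (2 * m + 1) * x = x ^ 2 ^ (m + 1)) : x ^ k = 1 := by
    rw [← pow_succ, ← hk, pow_add] at h
    exact (mul_eq_right₀ (pow_ne_zero _ hx)).1 h
  rcases h with h | h | h
  · exact Or.inl h
  · rcases hn with hn | hn
    · exact Or.inr (Or.inl (h1 n hn h))
    · rcases hn' with hn' | hn'
      · exact Or.inr (Or.inr (h1 n' hn' h))
      · omega
  · rcases hn with hn | hn
    · rcases hn' with hn' | hn'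
      · omega
      · exact Or.inr (Or.inr (h2 n' hn' h))
    · exact Or.inr (Or.inl (h2 n hn h))

lemma eq_one_of_pow_eq_one_of_pow_eq_one [CharP K 2] {x : K} {n n' k : ℕ}
    (h : n = n' + 2 ^ k ∨ n' = n + 2 ^ k) (hx : x ^ n = 1) (hx' : x ^ n' = 1) : x = 1 := by
  have h1 : x ^ 2 ^ k = 1 := by
    rcases h with rfl | rfl
    · rwa [pow_add, hx', one_mul] at hx
    · rwa [pow_add, hx, one_mul] at hx'
  have h2 : (x - 1) ^ 2 ^ k = 0 := by rw [sub_pow_char_pow, h1, one_pow, sub_self]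
  exact sub_eq_zero.1 (pow_eq_zero_iff (by positivity) |>.1 h2)

variable [CharP F 2] [Finite F] [Algebra F K] [IsAlgClosed K]

/-- Elements of S are separated by their values at an eigenvector v of g for x. The centralizer acts
on v by scalars, so it is enough to show that these are n-th roots of unity. -/
lemma anisotropic_centralizer (hF : Nat.card F = 2 ^ (2 * m + 1)) {n : ℕ}
    (hn : n = 2 ^ (2 * m + 1) + 2 ^ (m + 1) + 1 ∨ n + 2 ^ (m + 1) = 2 ^ (2 * m + 1) + 1)
    {x : K} (hx1 : x ≠ 1) (hx : x ^ n = 1) (g : Sz m F)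
    (hg : g.1.1.charpoly.aeval x = 0) :
    orderOf g = orderOf x ∧ Nat.card (Subgroup.centralizer {g}) ≤ n := by
  have := Fintype.ofFinite F
  have : CharP K 2 := charP_of_injective_algebraMap (algebraMap F K).injective 2
  have hn0 : n ≠ 0 := by
    have : 2 ^ (m + 1) ≤ 2 ^ (2 * m + 1) := Nat.pow_le_pow_right (by norm_num) (by omega)
    omega
  have hx0 : x ≠ 0 := by rintro rfl; simp [hn0] at hx
  have hφ := injective_frobenius_pow_apply (F := F) hx1 hx0
    (by rw [hF]; exact pow_pow_eq_inv_of_torus hn hx)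
  obtain ⟨v, hv, hgv⟩ := (exists_eigenvector_iff g.1.1 x).2 hg
  -- elements of the group that agree on the eigenvector are equal
  have hsep {h k : Sz m F} (hhk : h.1.1.map (algebraMap F K) *ᵥ v =
      k.1.1.map (algebraMap F K) *ᵥ v) : h = k := by
    have h0 := eq_zero_of_map_mulVec_eq_zero (M := h.1.1 - k.1.1) hφ hv hgv (by
      rw [Matrix.map_sub _ (map_sub _), Matrix.sub_mulVec, hhk, sub_self])
    exact Subtype.ext (Subtype.ext (sub_eq_zero.1 h0))
  have hmul (h k : Sz m F) : (h * k).1.1.map (algebraMap F K) =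
      h.1.1.map (algebraMap F K) * k.1.1.map (algebraMap F K) := Matrix.map_mul
  have hone : (1 : Sz m F).1.1.map (algebraMap F K) = 1 := Matrix.map_one _ (map_zero _) (map_one _)
  have hpow (k : ℕ) : (g ^ k).1.1.map (algebraMap F K) *ᵥ v = x ^ k • v := by
    induction k with
    | zero => simp
    | succ k ih => rw [pow_succ', hmul, ← Matrix.mulVec_mulVec, ih, Matrix.mulVec_smul, hgv,
        smul_smul, pow_succ]
  have hsmul {c : K} (h : c • v = v) : c = 1 := by
    by_contra hc
    have : (c - 1) • v = 0 := by rw [sub_smul, h, one_smul, sub_self]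
    exact (smul_eq_zero.1 this).elim (fun h => hc (sub_eq_zero.1 h)) hv
  refine ⟨orderOf_eq_orderOf_iff.2 fun k => ⟨fun h => ?_, fun h => ?_⟩, ?_⟩
  · apply hsmul
    rw [← hpow, h, hone, Matrix.one_mulVec]
  · apply hsep
    rw [hpow, h, one_smul, hone, Matrix.one_mulVec]
  obtain ⟨n', -, hnn', hn'⟩ := exists_complementary_torus hn
  have hne : n ≠ n' := by
    have : 0 < 2 ^ (m + 2) := by positivity
    omega
  -- eigenvalues of elements on the given vector
  have heig {h : Sz m F} {c : K} (hc : h.1.1.map (algebraMap F K) *ᵥ v = c • v) :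
      h = 1 ∨ c ^ n = 1 ∨ c ^ n' = 1 := by
    have hroot := (exists_eigenvector_iff h.1.1 c).1 ⟨v, hv, hc⟩
    rw [charpoly_of_mem_Sz hF h.2, aeval_quartic] at hroot
    have hc0 : c ≠ 0 := by rintro rfl; simp at hroot
    rcases pow_eq_one_of_torus_eq hc0 hn hn' hne (torus_of_root (by
      rw [← map_pow, ← map_pow, twist_twist hF, map_pow]) hroot) with h1 | h1
    -- An eigenvalue a in F makes h the scalar matrix a; then a⁴ = det h = 1, so a = 1 in
    -- characteristic 2.
    · left
      rw [← hF] at h1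
      obtain ⟨a, rfl⟩ := exists_algebraMap_eq h1
      have ha1 : (a • (1 : Matrix (Fin 4) (Fin 4) F)).map (algebraMap F K) =
          algebraMap F K a • 1 := by
        ext i j
        by_cases hij : i = j <;> simp [hij]
      have h0 := eq_zero_of_map_mulVec_eq_zero (M := h.1.1 - a • 1) hφ hv hgv (by
        rw [Matrix.map_sub _ (map_sub _), Matrix.sub_mulVec, hc, sub_eq_zero, ha1,
          Matrix.smul_mulVec, Matrix.one_mulVec])
      have h2 := sub_eq_zero.1 h0
      have hdet := h.1.2
      rw [h2, Matrix.det_smul, Matrix.det_one, mul_one, Fintype.card_fin] at hdet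
      have ha : a = 1 := by
        apply sq_injective
        apply sq_injective
        rw [← pow_mul, hdet]; simp
      apply Subtype.ext
      apply Subtype.ext
      rw [h2, ha, one_smul]
      rfl
    · exact Or.inr h1
  have hC (h : Subgroup.centralizer {g}) : ∃ c : K, h.1.1.1.map (algebraMap F K) *ᵥ v = c • v ∧
      c ^ n = 1 := by
    obtain ⟨h, hh⟩ := h
    rw [Subgroup.mem_centralizer_singleton_iff] at hh
    obtain ⟨c, hc⟩ := exists_smul_of_commute hφ (j₀ := 0) (by ext; simp) hv hgv (h := h.1.1)
      (congrArg (fun k : Sz m F => k.1.1) hh.symm)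
    refine ⟨c, hc, ?_⟩
    rcases heig hc with rfl | h1 | h1
    · rw [hone, Matrix.one_mulVec] at hc
      rw [hsmul hc.symm, one_pow]
    · exact h1
    -- If c lies in the complementary torus, the eigenvalue xc of gh decides: xc = 1 or (xc)^n = 1
    -- gives c^n = 1, while (xc)^n' = 1 would put x in both tori.
    · have hgh : (g * h).1.1.map (algebraMap F K) *ᵥ v = (x * c) • v := by
        rw [hmul, ← Matrix.mulVec_mulVec, hc, Matrix.mulVec_smul, hgv, smul_smul, mul_comm]
      rcases heig hgh with h2 | h2 | h2
      · rw [h2, hone, Matrix.one_mulVec] at hgh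
        have h3 := hsmul hgh.symm
        have h4 := congrArg (· ^ n) h3
        simpa [mul_pow, hx] using h4
      · simpa [mul_pow, hx] using h2
      · rw [mul_pow, h1, mul_one] at h2
        exact absurd (eq_one_of_pow_eq_one_of_pow_eq_one hnn' hx h2) hx1
  choose c hc hcn using hC
  have hinj : Function.Injective fun h => (⟨c h, by
      rw [Polynomial.mem_nthRootsFinset (Nat.pos_of_ne_zero hn0), hcn]⟩ :
        Polynomial.nthRootsFinset n (1 : K)) := by
    intro h k hhk
    have h1 : c h = c k := congrArg Subtype.val hhk
    apply Subtype.ext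
    apply hsep
    rw [hc, hc, h1]
  refine (Nat.card_le_card_of_injective _ hinj).trans ?_
  rw [Nat.card_eq_fintype_card, Fintype.card_coe]
  classical
  rw [Polynomial.nthRootsFinset_def]
  exact (Multiset.toFinset_card_le _).trans (Polynomial.card_nthRoots _ _)

end Anisotropic

end Suzuki

namespace Suzuki

variable {F : Type*} [Field F] {m : ℕ}

lemma trace_eq_of_isConj {g h : SL(4, F)} (hgh : IsConj g h) : g.1.trace = h.1.trace := by
  obtain ⟨c, rfl⟩ := isConj_iff.1 hgh
  rw [trace_mul_comm, inv_mul_cancel_left]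

variable [CharP F 2] [Finite F]

section Anisotropic

variable (F) in
-- The family is indexed by the primitive i-th roots of unity x in the algebraic closure, with an
-- element of S having eigenvalue x for each. Conjugate members share a quartic characteristic
-- polynomial, whence the factor 4.
lemma totient_mul_card_le_of_anisotropic (hF : Nat.card F = 2 ^ (2 * m + 1)) {n i : ℕ}
    (hn : n = 2 ^ (2 * m + 1) + 2 ^ (m + 1) + 1 ∨ n + 2 ^ (m + 1) = 2 ^ (2 * m + 1) + 1)
    (hi : 1 < i) (hin : i ∣ n) :
    i.totient * Nat.card (Sz m F) ≤ n * 4 * numOrder (Sz m F) i := by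
  classical
  let K := AlgebraicClosure F
  have : CharP K 2 := charP_of_injective_algebraMap (algebraMap F K).injective 2
  have hodd : ¬ 2 ∣ i := fun h => by
    have h1 := h.trans hin
    have h2 : 2 ∣ 2 ^ (2 * m + 1) := dvd_pow_self _ (by omega)
    have h3 : 2 ∣ 2 ^ (m + 1) := dvd_pow_self _ (by omega)
    omega
  have : NeZero (i : K) := ⟨fun h => hodd ((CharP.cast_eq_zero_iff K 2 i).1 h)⟩
  obtain ⟨ζ, hζ⟩ := HasEnoughRootsOfUnity.exists_primitiveRoot K i
  have hcard := hζ.card_primitiveRoots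
  have hprim (x : primitiveRoots i K) : IsPrimitiveRoot x.1 i :=
    (mem_primitiveRoots (by omega)).1 x.2
  have hex (x : primitiveRoots i K) : ∃ g : Sz m F, g.1.1.charpoly.aeval x.1 = 0 := by
    have hxn : x.1 ^ n = 1 := by
      obtain ⟨k, rfl⟩ := hin
      rw [pow_mul, (hprim x).pow_eq_one, one_pow]
    have hx0 : x.1 ≠ 0 := (hprim x).ne_zero (by omega)
    have hyy := pow_pow_eq_inv_of_torus hn hxn
    have h := root_of_torus (m := m) hx0 rfl hyy (torus_eq_of_pow_eq_one hn hxn)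
    set s := x.1 + x.1 ^ 2 ^ (2 * m + 1) + x.1⁻¹ + (x.1 ^ 2 ^ (2 * m + 1))⁻¹ with hs
    -- The q-th power permutes the four summands cyclically, so s comes from F and is the trace of
    -- some element of S.
    have hsq : s ^ Nat.card F = s := by
      rw [hF, hs]
      simp only [add_pow_char_pow, inv_pow, hyy]
      rw [inv_inv]
      ring
    obtain ⟨a, ha⟩ := exists_algebraMap_eq hsq
    obtain ⟨g, hg, hga⟩ := exists_trace_eq hF a
    refine ⟨⟨g, hg⟩, ?_⟩
    rw [charpoly_of_mem_Sz hF hg, aeval_quartic, hga, ha, h]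
  choose γ hγ using hex
  have hanis (x : primitiveRoots i K) := anisotropic_centralizer hF hn (x := x.1)
    (fun h => by have := (hprim x).eq_orderOf; rw [h, orderOf_one] at this; omega)
    (by obtain ⟨k, rfl⟩ := hin; rw [pow_mul, (hprim x).pow_eq_one, one_pow]) (γ x) (hγ x)
  have := card_mul_card_le_mul_numOrder (n := i) (k := 4) (c := n) γ
    (fun x => by rw [(hanis x).1, ← (hprim x).eq_orderOf]) ?_ (fun x => (hanis x).2)
  · rwa [Fintype.card_coe, hcard] at this
  · intro x
    set p := (γ x).1.1.charpoly with hp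
    have hp0 : p.map (algebraMap F K) ≠ 0 :=
      Polynomial.map_ne_zero (Matrix.charpoly_monic _).ne_zero
    have hconj {y} (h : IsConj (γ x) (γ y)) : (p.map (algebraMap F K)).IsRoot y.1 := by
      have h1 : (γ x).1.1.trace = (γ y).1.1.trace :=
        trace_eq_of_isConj (MonoidHom.map_isConj (Sz m F).subtype h)
      rw [Polynomial.IsRoot, Polynomial.eval_map, ← Polynomial.aeval_def, hp,
        charpoly_of_mem_Sz hF (γ x).2, h1, ← charpoly_of_mem_Sz hF (γ y).2, hγ]
    have hinj : Function.Injective fun y : {y // IsConj (γ x) (γ y)} =>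
        (⟨y.1.1, Multiset.mem_toFinset.2 ((Polynomial.mem_roots hp0).2 (hconj y.2))⟩ :
          (p.map (algebraMap F K)).roots.toFinset) := by
      intro y z h
      exact Subtype.ext (Subtype.ext (congrArg (fun z => z.1) h))
    refine (Nat.card_le_card_of_injective _ hinj).trans ?_
    rw [Nat.card_eq_fintype_card, Fintype.card_coe]
    refine (Multiset.toFinset_card_le _).trans ((Polynomial.card_roots' _).trans ?_)
    rw [Polynomial.natDegree_map, hp, Matrix.charpoly_natDegree_eq_dim, Fintype.card_fin]

end Anisotropic

/-! ### The split torus of diagonal matrices -/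

section Split

omit [CharP F 2] [Finite F] in
lemma trace_d (κ : Fˣ) : (d m κ).1.trace = (κ + (κ : F)⁻¹) +
    (κ * (κ : F) ^ 2 ^ (m + 1) + ((κ : F) * (κ : F) ^ 2 ^ (m + 1))⁻¹) := by
  rw [coe_d]
  simp [Matrix.trace, Fin.sum_univ_four]
  ring

lemma trace_d_twist (hF : Nat.card F = 2 ^ (2 * m + 1)) (κ : Fˣ) :
    (d m κ).1.trace ^ 2 ^ (m + 1) = (κ + (κ : F)⁻¹) *
      (κ * (κ : F) ^ 2 ^ (m + 1) + ((κ : F) * (κ : F) ^ 2 ^ (m + 1))⁻¹) := by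
  have h := twist_twist hF (κ : F)
  have h0 : (κ : F) ≠ 0 := κ.ne_zero
  have h1 : (κ : F) ^ 2 ^ (m + 1) ≠ 0 := pow_ne_zero _ h0
  rw [trace_d]
  simp only [twist_add, mul_pow, inv_pow, h]
  clear h
  generalize (κ : F) ^ 2 ^ (m + 1) = k at *
  field_simp
  ring

/-- The trace and its twist are the sum and the product of κ + κ⁻¹ and κ^(1+t) + κ^(-(1+t)), so they
determine this unordered pair. Equality of like terms gives l = κ^(±1). -/
lemma eq_or_eq_inv_of_trace_d_eq (hF : Nat.card F = 2 ^ (2 * m + 1)) {κ l : Fˣ}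
    (h : (d m κ).1.trace = (d m l).1.trace) : l = κ ∨ l = κ⁻¹ := by
  have hprod := congrArg (· ^ 2 ^ (m + 1)) h
  simp only [trace_d_twist hF] at hprod
  rw [trace_d, trace_d] at h
  have hinv {x y : Fˣ} (h : (x : F) + (x : F)⁻¹ = y + (y : F)⁻¹) : x = y ∨ x = y⁻¹ := by
    rcases eq_or_mul_eq_one_of_add_inv_eq x.ne_zero y.ne_zero h with h | h
    · exact Or.inl (Units.ext h)
    · exact Or.inr (eq_inv_of_mul_eq_one_left (Units.ext h))
  have hcoe (x : Fˣ) : (x : F) * (x : F) ^ 2 ^ (m + 1) = ((x * x ^ 2 ^ (m + 1) : Fˣ) : F) := by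
    push_cast; rfl
  have hcase : ((l : F) + (l : F)⁻¹ - (κ + (κ : F)⁻¹)) * ((l : F) + (l : F)⁻¹ -
      (κ * (κ : F) ^ 2 ^ (m + 1) + ((κ : F) * (κ : F) ^ 2 ^ (m + 1))⁻¹)) = 0 := by
    linear_combination hprod - ((l : F) + (l : F)⁻¹) * h
  rcases mul_eq_zero.1 hcase with h1 | h1
  · exact hinv (sub_eq_zero.1 h1)
  · have h2 := sub_eq_zero.1 h1
    have h3 : (κ + (κ : F)⁻¹) =
        (l * (l : F) ^ 2 ^ (m + 1) + ((l : F) * (l : F) ^ 2 ^ (m + 1))⁻¹) := by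
      linear_combination h + h2
    rw [hcoe] at h2 h3
    have htt (x : Fˣ) : (x ^ 2 ^ (m + 1)) ^ 2 ^ (m + 1) = x ^ 2 :=
      Units.ext (by push_cast; exact twist_twist hF _)
    -- A crossed matching gives l = κ^(±(1+t)) and l^(1+t) = κ^(±1), that is κ^((1+t)²) = κ^(±1);
    -- this forces κ = 1.
    have hP : (κ * κ ^ 2 ^ (m + 1)) * (κ ^ 2 ^ (m + 1) * κ ^ 2) = κ ∨
        (κ * κ ^ 2 ^ (m + 1)) * (κ ^ 2 ^ (m + 1) * κ ^ 2) = κ⁻¹ := by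
      rw [← htt κ, ← mul_pow]
      rcases hinv h2 with rfl | rfl <;> rcases hinv h3 with h4 | h4
      · exact Or.inl h4.symm
      · exact Or.inr (inv_eq_iff_eq_inv.1 h4.symm)
      · rw [inv_pow, ← mul_inv] at h4
        exact Or.inr (inv_eq_iff_eq_inv.1 h4.symm)
      · rw [inv_pow, ← mul_inv, inv_inv] at h4
        exact Or.inl h4.symm
    have hκ : (κ : F) = 1 := by
      rcases hP with h4 | h4 <;> have h5 := congrArg (Units.val) h4 <;> push_cast at h5
      · apply mul_twist_eq_one hF
        apply sq_injective
        apply mul_left_cancel₀ κ.ne_zero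
        linear_combination h5
      · apply sq_mul_twist_eq_one hF
        apply sq_injective
        have h6 : (κ : F) * (κ : F)⁻¹ = 1 := mul_inv_cancel₀ κ.ne_zero
        linear_combination (κ : F) * h5 + h6
    obtain rfl : κ = 1 := Units.ext hκ
    rcases hinv h2 with rfl | rfl <;> simp

/-- The first diagonal entry of `d m κ` differs from the other three. Comparing the (0,3) entries
therefore makes a commuting element lower triangular, and the (1,0) and (2,0) entries then kill its
unipotent part. -/
lemma split_centralizer (hF : Nat.card F = 2 ^ (2 * m + 1)) {κ : Fˣ} (hκ : κ ≠ 1) :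
    Nat.card (Subgroup.centralizer {(⟨d m κ, d_mem_Sz κ⟩ : Sz m F)}) ≤ Nat.card F - 1 := by
  have hk1 : (κ : F) ≠ 1 := fun h => hκ (Units.ext h)
  have hk0 : (κ : F) ≠ 0 := κ.ne_zero
  have hC (h : Subgroup.centralizer {(⟨d m κ, d_mem_Sz κ⟩ : Sz m F)}) :
      ∃ l : Fˣ, h.1.1 = d m l := by
    obtain ⟨⟨h, hS⟩, hh⟩ := h
    rw [Subgroup.mem_centralizer_singleton_iff] at hh
    have hcomm : h * d m κ = d m κ * h := congrArg Subtype.val hh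
    have hent (i j : Fin 4) := congrArg (fun g : SL(4, F) => g i j) hcomm
    simp only [Matrix.SpecialLinearGroup.coe_mul, coe_d, Matrix.mul_apply,
      Fin.sum_univ_four] at hent
    have hne1 : (κ : F) * (κ : F) ^ 2 ^ (m + 1) ≠ κ := fun h =>
      hk1 (twist_eq_one hF (mul_left_cancel₀ hk0 (h.trans (mul_one _).symm)))
    have hne2 : (κ : F) * (κ : F) ^ 2 ^ (m + 1) ≠ (κ : F)⁻¹ := fun h =>
      hk1 (sq_mul_twist_eq_one hF (by rw [sq, mul_assoc, h, mul_inv_cancel₀ hk0]))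
    have hne3 : (κ : F) * (κ : F) ^ 2 ^ (m + 1) ≠ ((κ : F) * (κ : F) ^ 2 ^ (m + 1))⁻¹ := fun h => by
      refine hk1 (mul_twist_eq_one hF (sq_injective ?_))
      nth_rw 1 [sq]
      nth_rw 2 [h]
      rw [mul_inv_cancel₀ (mul_ne_zero hk0 (pow_ne_zero _ hk0)), one_pow]
    have h03 : h 0 3 = 0 := by
      have := hent 0 3
      simp [-mul_inv_rev] at this
      by_contra h0
      exact hne3 (mul_left_cancel₀ h0 (by linear_combination -this))
    obtain ⟨a, b, l, rfl⟩ := exists_eq_w_mul_d hF hS h03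
    refine ⟨l, ?_⟩
    have h1 := hent 1 0
    have h2 := hent 2 0
    have e1 : (w m a b * d m l : SL(4, F)) 1 0 = a * (l * (l : F) ^ 2 ^ (m + 1)) := by
      simp [Matrix.SpecialLinearGroup.coe_mul, coe_w, coe_d, Matrix.mul_apply, Fin.sum_univ_four]
    have e2 : (w m a b * d m l : SL(4, F)) 2 0 = b * (l * (l : F) ^ 2 ^ (m + 1)) := by
      simp [Matrix.SpecialLinearGroup.coe_mul, coe_w, coe_d, Matrix.mul_apply, Fin.sum_univ_four]
    simp [-Matrix.SpecialLinearGroup.coe_mul, -mul_inv_rev, e1, e2] at h1 h2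
    have hl0 : (l : F) * (l : F) ^ 2 ^ (m + 1) ≠ 0 :=
      mul_ne_zero l.ne_zero (pow_ne_zero _ l.ne_zero)
    have ha : a = 0 := by
      by_contra ha
      exact hne1 (mul_left_cancel₀ (mul_ne_zero ha hl0) (by linear_combination h1))
    have hb : b = 0 := by
      by_contra hb
      exact hne2 (mul_left_cancel₀ (mul_ne_zero hb hl0) (by linear_combination h2))
    change w m a b * d m l = d m l
    rw [ha, hb, w_zero, one_mul]
  choose l hl using hC
  have hinj : Function.Injective l := fun h k hhk =>
    Subtype.ext (Subtype.ext (by rw [hl, hl, hhk]))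
  refine (Nat.card_le_card_of_injective _ hinj).trans ?_
  rw [Nat.card_units]

/-- The torus of diagonal matrices, as a homomorphism into the Suzuki group. -/
def dHom (m : ℕ) (F : Type*) [Field F] : Fˣ →* Sz m F where
  toFun κ := ⟨d m κ, d_mem_Sz κ⟩
  map_one' := Subtype.ext d_one
  map_mul' κ l := Subtype.ext (d_mul_d κ l).symm

omit [CharP F 2] [Finite F] in
lemma dHom_injective : Function.Injective (dHom m F) := fun κ l h => by
  have := congrArg (fun g : Sz m F => g.1 1 1) h
  simp only [dHom, MonoidHom.coe_mk, OneHom.coe_mk, coe_d] at this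
  exact Units.ext (by simpa using this)

variable (F) in
lemma totient_mul_card_le_of_split (hF : Nat.card F = 2 ^ (2 * m + 1)) {i : ℕ}
    (hi : 1 < i) (hin : i ∣ Nat.card F - 1) :
    i.totient * Nat.card (Sz m F) ≤ (Nat.card F - 1) * 2 * numOrder (Sz m F) i := by
  classical
  have := Fintype.ofFinite F
  have hcard : Fintype.card {κ : Fˣ // orderOf κ = i} = i.totient := by
    rw [Fintype.card_subtype]
    apply IsCyclic.card_orderOf_eq_totient
    rwa [← Nat.card_eq_fintype_card, Nat.card_units]
  rw [← hcard]
  refine card_mul_card_le_mul_numOrder (fun κ : {κ : Fˣ // orderOf κ = i} => dHom m F κ.1)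
    (fun κ => ?_) (fun κ => ?_) (fun κ => ?_)
  · rw [orderOf_injective _ dHom_injective, κ.2]
  · have hsub (l : {l : {κ : Fˣ // orderOf κ = i} // IsConj (dHom m F κ.1) (dHom m F l.1)}) :
        l.1.1 ∈ ({κ.1, κ.1⁻¹} : Finset Fˣ) := by
      have h := trace_eq_of_isConj (MonoidHom.map_isConj (Sz m F).subtype l.2)
      simpa using eq_or_eq_inv_of_trace_d_eq hF h
    have hinj : Function.Injective fun l => (⟨l.1.1, hsub l⟩ : ({κ.1, κ.1⁻¹} : Finset Fˣ)) := by
      intro l k h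
      exact Subtype.ext (Subtype.ext (congrArg (fun z => z.1) h))
    refine (Nat.card_le_card_of_injective _ hinj).trans ?_
    rw [Nat.card_eq_fintype_card, Fintype.card_coe]
    exact Finset.card_le_two
  · refine split_centralizer hF fun h => ?_
    have := κ.2
    rw [h, orderOf_one] at this
    omega

end Split

/-! ### Elements of orders 2 and 4 -/

section Unipotent

lemma orderOf_w_eq_two (hF : Nat.card F = 2 ^ (2 * m + 1)) {b : F} (hb : b ≠ 0) :
    orderOf (w m 0 b) = 2 := by
  refine orderOf_eq_prime ?_ fun h => hb ?_
  · rw [w_sq hF]; simp [w_zero]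
  · rw [← w_zero (m := m)] at h
    exact (w_injective h).2

lemma orderOf_w_eq_four (hF : Nat.card F = 2 ^ (2 * m + 1)) {a : F} (ha : a ≠ 0) (b : F) :
    orderOf (w m a b) = 4 := by
  have h0 : a * a ^ 2 ^ (m + 1) ≠ 0 := mul_ne_zero ha (pow_ne_zero _ ha)
  refine orderOf_eq_prime_pow (p := 2) (n := 1) ?_ ?_
  · rw [pow_one, w_sq hF, ← w_zero (m := m)]
    exact fun h => h0 (w_injective h).2
  · rw [pow_succ, pow_one, pow_mul, w_sq hF, w_sq hF]; simp [w_zero]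

/-- Conjugates of nontrivial elements of the unipotent subgroup by distinct coset representatives
are distinct. -/
lemma card_le_numOrder_of_unipotent (hF : Nat.card F = 2 ^ (2 * m + 1)) {ι : Type*} [Finite ι]
    {i : ℕ} (u : ι → F × F) (hu : Function.Injective u) (hu0 : ∀ j, (u j).1 ≠ 0 ∨ (u j).2 ≠ 0)
    (hord : ∀ j, orderOf (w m (u j).1 (u j).2) = i) :
    (Nat.card F ^ 2 + 1) * Nat.card ι ≤ numOrder (Sz m F) i := by
  have hcard : Nat.card (Option (F × F) × ι) = (Nat.card F ^ 2 + 1) * Nat.card ι := by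
    rw [Nat.card_prod, Finite.card_option, Nat.card_prod, sq]
  let r (o : Option (F × F)) : Sz m F := ⟨cosetRep m o, cosetRep_mem_Sz o⟩
  let v (j : ι) : Sz m F := ⟨w m (u j).1 (u j).2, w_mem_Sz _ _⟩
  have hv (j : ι) : orderOf (v j) = i := by rw [← hord j, ← Subgroup.orderOf_coe]
  rw [← hcard, numOrder]
  refine Nat.card_le_card_of_injective (fun p : Option (F × F) × ι =>
    (⟨r p.1 * v p.2 * (r p.1)⁻¹, by
      rw [← hv p.2, ← MulAut.conj_apply]; exact MulEquiv.orderOf_eq _ _⟩ :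
        {g : Sz m F // orderOf g = i})) ?_
  rintro ⟨o, j⟩ ⟨o', j'⟩ h
  have h1 : r o * v j * (r o)⁻¹ = r o' * v j' * (r o')⁻¹ := congrArg Subtype.val h
  have h2 : (r o')⁻¹ * r o * v j = v j' * ((r o')⁻¹ * r o) := by
    calc (r o')⁻¹ * r o * v j = (r o')⁻¹ * (r o * v j * (r o)⁻¹) * r o := by group
      _ = v j' * ((r o')⁻¹ * r o) := by rw [h1]; group
  -- The quotient of the two representatives intertwines nontrivial unipotent elements, so its
  -- corner entry vanishes.
  have h3 : o' = o := cosetRep_eq_of_apply_eq_zero hF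
    (apply_zero_three_eq_zero (hu0 j) (congrArg Subtype.val h2))
  subst h3
  have h4 := mul_left_cancel (mul_right_cancel h1)
  obtain ⟨h5, h6⟩ := w_injective (congrArg Subtype.val h4)
  rw [hu (Prod.ext h5 h6)]

variable (F) in
lemma card_le_numOrder_two (hF : Nat.card F = 2 ^ (2 * m + 1)) :
    (Nat.card F ^ 2 + 1) * (Nat.card F - 1) ≤ numOrder (Sz m F) 2 := by
  rw [← Nat.card_units]
  exact card_le_numOrder_of_unipotent hF (fun b : Fˣ => ((0 : F), (b : F)))
    (fun b b' h => Units.ext (congrArg Prod.snd h)) (fun b => Or.inr b.ne_zero)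
    (fun b => orderOf_w_eq_two hF b.ne_zero)

variable (F) in
lemma card_le_numOrder_four (hF : Nat.card F = 2 ^ (2 * m + 1)) :
    (Nat.card F ^ 2 + 1) * ((Nat.card F - 1) * Nat.card F) ≤ numOrder (Sz m F) 4 := by
  rw [← Nat.card_units, ← Nat.card_prod]
  exact card_le_numOrder_of_unipotent hF (fun p : Fˣ × F => ((p.1 : F), p.2))
    (fun p p' h => Prod.ext (Units.ext (Prod.mk.inj h).1) (Prod.mk.inj h).2)
    (fun p => Or.inl p.1.ne_zero)
    (fun p => orderOf_w_eq_four hF p.1.ne_zero p.2)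

end Unipotent

end Suzuki

/-! ### Adding up the lower bounds -/

lemma sum_numOrder_le_card (G : Type*) [Group G] [Finite G] (I : Finset ℕ) :
    ∑ i ∈ I, numOrder G i ≤ Nat.card G := by
  classical
  have := Fintype.ofFinite G
  have h (i : ℕ) : numOrder G i = (Finset.univ.filter fun g : G => orderOf g = i).card := by
    rw [numOrder, Nat.card_eq_fintype_card, Fintype.card_subtype]
  simp only [h]
  rw [← Finset.card_biUnion, Nat.card_eq_fintype_card]
  · exact Finset.card_le_univ _
  · intro i _ j _ hij
    rw [Function.onFun, Finset.disjoint_left]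
    intro g hg hg'
    exact hij ((Finset.mem_filter.1 hg).2.symm.trans (Finset.mem_filter.1 hg').2)

lemma numOrder_pos_iff {G : Type*} [Group G] [Finite G] {i : ℕ} :
    0 < numOrder G i ↔ i ∈ spectrumOrders G := by
  rw [numOrder, Finite.card_pos_iff, nonempty_subtype]
  rfl

lemma sum_totient_divisors_erase_one {n : ℕ} (hn : 0 < n) :
    ∑ i ∈ n.divisors.erase 1, (i.totient : ℚ) = n - 1 := by
  have h := Finset.add_sum_erase n.divisors (fun i => (i.totient : ℚ))
    (Nat.one_mem_divisors.2 hn.ne')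
  simp only [← Nat.cast_sum, Nat.sum_totient, Nat.totient_one, Nat.cast_one] at h ⊢
  linarith

namespace Suzuki

variable (F : Type*) [Field F] (m : ℕ)

/-- The numbers of elements of each order in the Suzuki group, and its set of element orders. -/
lemma numOrder_Sz_eq [CharP F 2] [Finite F] {q A B : ℕ} (hF : Nat.card F = 2 ^ (2 * m + 1))
    (hq : Nat.card F = q) (hA : A = q + 2 ^ (m + 1) + 1) (hB : B + 2 ^ (m + 1) = q + 1) :
    numOrder (Sz m F) 1 = 1 ∧
    (numOrder (Sz m F) 2 : ℚ) = ((q : ℚ) - 1) * ((q : ℚ) ^ 2 + 1) ∧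
    (numOrder (Sz m F) 4 : ℚ) = (q : ℚ) * ((q : ℚ) - 1) * ((q : ℚ) ^ 2 + 1) ∧
    (∀ i, 1 < i → i ∣ A → (numOrder (Sz m F) i : ℚ) =
      i.totient * (q : ℚ) ^ 2 * B * ((q : ℚ) - 1) / 4) ∧
    (∀ i, 1 < i → i ∣ B → (numOrder (Sz m F) i : ℚ) =
      i.totient * (q : ℚ) ^ 2 * A * ((q : ℚ) - 1) / 4) ∧
    (∀ i, 1 < i → i ∣ q - 1 → (numOrder (Sz m F) i : ℚ) =
      i.totient * (q : ℚ) ^ 2 * ((q : ℚ) ^ 2 + 1) / 2) ∧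
    ∀ i, i ∈ spectrumOrders (Sz m F) ↔ i = 1 ∨ i = 2 ∨ i = 4 ∨ (1 < i ∧ i ∣ A) ∨
      (1 < i ∧ i ∣ B) ∨ (1 < i ∧ i ∣ q - 1) := by
  have hq2 : q = 2 ^ (2 * m + 1) := hq.symm.trans hF
  have hcard := card_Sz hF
  have htq : 2 ^ (m + 1) ≤ q := hq2 ▸ Nat.pow_le_pow_right (by norm_num) (by omega)
  have ht2 : 2 ≤ 2 ^ (m + 1) := by rw [pow_succ]; have := Nat.one_le_two_pow (n := m); omega
  have hAn : A = 2 ^ (2 * m + 1) + 2 ^ (m + 1) + 1 ∨ A + 2 ^ (m + 1) = 2 ^ (2 * m + 1) + 1 :=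
    Or.inl (by rw [hA, hq2])
  have hBn : B = 2 ^ (2 * m + 1) + 2 ^ (m + 1) + 1 ∨ B + 2 ^ (m + 1) = 2 ^ (2 * m + 1) + 1 :=
    Or.inr (by rw [hB, hq2])
  have htt : (2 ^ (m + 1)) ^ 2 = 2 * q := by rw [hq2]; ring
  have hqe : 2 ∣ q := hq2 ▸ dvd_pow_self _ (by omega)
  have hte : 2 ∣ 2 ^ (m + 1) := dvd_pow_self _ (by omega)
  have hAB2 : A = B + 2 ^ (m + 2) := by rw [pow_succ 2 (m + 1)]; omega
  rw [hq] at hcard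
  have hq1 : ((q - 1 : ℕ) : ℚ) = q - 1 := by rw [Nat.cast_sub (by omega), Nat.cast_one]
  have hAQ : (A : ℚ) = q + 2 ^ (m + 1) + 1 := by rw [hA]; push_cast; ring
  have hBQ : (B : ℚ) = q - 2 ^ (m + 1) + 1 := by
    have := congrArg (Nat.cast : ℕ → ℚ) hB
    push_cast at this
    linarith
  have httQ : ((2 : ℚ) ^ (m + 1)) ^ 2 = 2 * q := by exact_mod_cast htt
  have hAB : (A : ℚ) * B = (q : ℚ) ^ 2 + 1 := by
    rw [hAQ, hBQ]; linear_combination -httQ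
  have hcardQ : (Nat.card (Sz m F) : ℚ) = ((q : ℚ) ^ 2 + 1) * ((q : ℚ) ^ 2 * (q - 1)) := by
    rw [hcard]; push_cast; rw [hq1]
  have hA0 : (0 : ℚ) < A := by rw [hA]; positivity
  have hB0 : (0 : ℚ) < B := by have : 0 < B := by omega
                               exact_mod_cast this
  have hq10 : (0 : ℚ) < q - 1 := by rw [← hq1]; have : 0 < q - 1 := by omega
                                    exact_mod_cast this
  have hq0 : (0 : ℚ) < q := by linarith
  set M := fun i => (numOrder (Sz m F) i : ℚ) with hM
  -- lower bounds
  have l1 : 1 ≤ M 1 := by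
    have : 0 < numOrder (Sz m F) 1 := numOrder_pos_iff.2 ⟨1, orderOf_one⟩
    exact Nat.one_le_cast.2 this
  have l2 : ((q : ℚ) - 1) * ((q : ℚ) ^ 2 + 1) ≤ M 2 := by
    have := card_le_numOrder_two F hF
    rw [hq] at this
    have : (((q ^ 2 + 1) * (q - 1) : ℕ) : ℚ) ≤ M 2 := Nat.cast_le.2 this
    push_cast at this
    rw [hq1] at this
    linarith
  have l4 : (q : ℚ) * ((q : ℚ) - 1) * ((q : ℚ) ^ 2 + 1) ≤ M 4 := by
    have := card_le_numOrder_four F hF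
    rw [hq] at this
    have : (((q ^ 2 + 1) * ((q - 1) * q) : ℕ) : ℚ) ≤ M 4 := Nat.cast_le.2 this
    push_cast at this
    rw [hq1] at this
    linarith
  have lA (i) (hi : 1 < i) (hin : i ∣ A) :
      i.totient * (q : ℚ) ^ 2 * B * ((q : ℚ) - 1) / 4 ≤ M i := by
    have := totient_mul_card_le_of_anisotropic F hF hAn hi hin
    have : ((i.totient * Nat.card (Sz m F) : ℕ) : ℚ) ≤ (A * 4 * numOrder (Sz m F) i : ℕ) := by
      exact_mod_cast this
    rw [Nat.cast_mul, hcardQ, ← hAB] at this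
    push_cast at this
    rw [div_le_iff₀ (by norm_num)]
    refine le_of_mul_le_mul_left ?_ hA0
    linarith
  have lB (i) (hi : 1 < i) (hin : i ∣ B) :
      i.totient * (q : ℚ) ^ 2 * A * ((q : ℚ) - 1) / 4 ≤ M i := by
    have := totient_mul_card_le_of_anisotropic F hF hBn hi hin
    have : ((i.totient * Nat.card (Sz m F) : ℕ) : ℚ) ≤ (B * 4 * numOrder (Sz m F) i : ℕ) := by
      exact_mod_cast this
    rw [Nat.cast_mul, hcardQ, ← hAB] at this
    push_cast at this
    rw [div_le_iff₀ (by norm_num)]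
    refine le_of_mul_le_mul_left ?_ hB0
    linarith
  have lC (i) (hi : 1 < i) (hin : i ∣ q - 1) :
      i.totient * (q : ℚ) ^ 2 * ((q : ℚ) ^ 2 + 1) / 2 ≤ M i := by
    have := totient_mul_card_le_of_split F hF hi (by rwa [hq])
    rw [hq] at this
    have : ((i.totient * Nat.card (Sz m F) : ℕ) : ℚ) ≤
        ((q - 1) * 2 * numOrder (Sz m F) i : ℕ) := by exact_mod_cast this
    rw [Nat.cast_mul, hcardQ] at this
    push_cast at this
    rw [hq1] at this
    rw [div_le_iff₀ (by norm_num)]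
    refine le_of_mul_le_mul_left ?_ hq10
    linarith
  have hmem {n i : ℕ} (hn : 0 < n) : i ∈ n.divisors.erase 1 ↔ 1 < i ∧ i ∣ n := by
    rw [Finset.mem_erase, Nat.mem_divisors]
    constructor
    · rintro ⟨h1, h2, -⟩
      have := Nat.pos_of_dvd_of_pos h2 hn
      exact ⟨by omega, h2⟩
    · rintro ⟨h1, h2⟩
      exact ⟨by omega, h2, hn.ne'⟩
  have hAp : 0 < A := by omega
  have hBp : 0 < B := by omega
  have hCp : 0 < q - 1 := by omega
  -- summed lower bounds
  have sA := Finset.sum_le_sum fun i (hi : i ∈ A.divisors.erase 1) =>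
    lA i ((hmem hAp).1 hi).1 ((hmem hAp).1 hi).2
  have sB := Finset.sum_le_sum fun i (hi : i ∈ B.divisors.erase 1) =>
    lB i ((hmem hBp).1 hi).1 ((hmem hBp).1 hi).2
  have sC := Finset.sum_le_sum fun i (hi : i ∈ (q - 1).divisors.erase 1) =>
    lC i ((hmem hCp).1 hi).1 ((hmem hCp).1 hi).2
  have eA : ∑ i ∈ A.divisors.erase 1, (i.totient * (q : ℚ) ^ 2 * B * ((q : ℚ) - 1) / 4) =
      (A - 1) * (q : ℚ) ^ 2 * B * ((q : ℚ) - 1) / 4 := by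
    rw [← sum_totient_divisors_erase_one hAp]
    simp only [Finset.sum_mul, Finset.sum_div]
  have eB : ∑ i ∈ B.divisors.erase 1, (i.totient * (q : ℚ) ^ 2 * A * ((q : ℚ) - 1) / 4) =
      (B - 1) * (q : ℚ) ^ 2 * A * ((q : ℚ) - 1) / 4 := by
    rw [← sum_totient_divisors_erase_one hBp]
    simp only [Finset.sum_mul, Finset.sum_div]
  have eC : ∑ i ∈ (q - 1).divisors.erase 1, (i.totient * (q : ℚ) ^ 2 * ((q : ℚ) ^ 2 + 1) / 2) =
      (q - 1 - 1) * (q : ℚ) ^ 2 * ((q : ℚ) ^ 2 + 1) / 2 := by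
    rw [← hq1, ← sum_totient_divisors_erase_one hCp]
    simp only [Finset.sum_mul, Finset.sum_div]
  -- the index sets are disjoint
  have hAodd {i} (h : i ∣ A) : ¬ 2 ∣ i := fun h2 => by have := h2.trans h; omega
  have hBodd {i} (h : i ∣ B) : ¬ 2 ∣ i := fun h2 => by have := h2.trans h; omega
  have hCodd {i} (h : i ∣ q - 1) : ¬ 2 ∣ i := fun h2 => by have := h2.trans h; omega
  have hpow {i k : ℕ} (h : i ∣ 2 ^ k) (h2 : ¬ 2 ∣ i) : i = 1 := by
    obtain ⟨j, -, rfl⟩ := (Nat.dvd_prime_pow Nat.prime_two).1 h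
    rcases j with _ | j
    · rfl
    · exact absurd (dvd_pow_self 2 (by omega)) h2
  have dAB : Disjoint (A.divisors.erase 1) (B.divisors.erase 1) := by
    rw [Finset.disjoint_left]
    intro i hi hi'
    rw [hmem hAp] at hi
    rw [hmem hBp] at hi'
    -- A common divisor of A and B divides A - B = 2^(m+2) and is odd.
    have := hpow ((Nat.dvd_add_right hi'.2).1 (hAB2 ▸ hi.2)) (hAodd hi.2)
    omega
  have hABN : A * B = q ^ 2 + 1 := by exact_mod_cast hAB
  have hsq : q ^ 2 + 1 = (q - 1) * (q + 1) + 2 := by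
    obtain ⟨k, rfl⟩ : ∃ k, q = k + 1 := ⟨q - 1, by omega⟩
    simp only [Nat.add_sub_cancel]
    ring
  have hdisjC {i} (h1 : 1 < i) (h : i ∣ q ^ 2 + 1) (h' : i ∣ q - 1) : False := by
    rw [hsq] at h
    have h2 : i ∣ 2 ^ 1 := (Nat.dvd_add_right (h'.mul_right _)).1 h
    have := hpow h2 (hCodd h')
    omega
  have dABC : Disjoint (A.divisors.erase 1 ∪ B.divisors.erase 1) ((q - 1).divisors.erase 1) := by
    rw [Finset.disjoint_left]
    intro i hi hi'
    rw [hmem hCp] at hi'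
    rw [Finset.mem_union, hmem hAp, hmem hBp, ← and_or_left] at hi
    refine hdisjC hi.1 ?_ hi'.2
    rw [← hABN]
    exact hi.2.elim (fun h => h.mul_right _) (fun h => h.mul_left _)
  set D := A.divisors.erase 1 ∪ B.divisors.erase 1 ∪ (q - 1).divisors.erase 1 with hD
  have hDmem {i} : i ∈ D ↔ (1 < i ∧ i ∣ A) ∨ (1 < i ∧ i ∣ B) ∨ (1 < i ∧ i ∣ q - 1) := by
    rw [hD, Finset.mem_union, Finset.mem_union, hmem hAp, hmem hBp, hmem hCp, or_assoc]
  have d124 : Disjoint ({1, 2, 4} : Finset ℕ) D := by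
    rw [Finset.disjoint_right]
    intro i hi hi'
    rw [hDmem] at hi
    have h2 : ¬ 2 ∣ i ∧ 1 < i := by
      rcases hi with h | h | h
      · exact ⟨hAodd h.2, h.1⟩
      · exact ⟨hBodd h.2, h.1⟩
      · exact ⟨hCodd h.2, h.1⟩
    simp only [Finset.mem_insert, Finset.mem_singleton] at hi'
    omega
  have hsum : ∑ i ∈ {1, 2, 4} ∪ D, M i = M 1 + M 2 + M 4 + (∑ i ∈ A.divisors.erase 1, M i +
      ∑ i ∈ B.divisors.erase 1, M i + ∑ i ∈ (q - 1).divisors.erase 1, M i) := by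
    rw [Finset.sum_union d124, hD, Finset.sum_union dABC, Finset.sum_union dAB]
    simp [add_assoc]
  have htot (I : Finset ℕ) : ∑ i ∈ I, M i ≤ ((q : ℚ) ^ 2 + 1) * ((q : ℚ) ^ 2 * (q - 1)) := by
    rw [← hcardQ, hM, ← Nat.cast_sum]
    exact_mod_cast sum_numOrder_le_card _ _
  -- The lower bounds add up to exactly |S|; after substituting A and B this is a multiple of t² =
  -- 2q.
  have hcount : 1 + ((q : ℚ) - 1) * ((q : ℚ) ^ 2 + 1) + (q : ℚ) * ((q : ℚ) - 1) * ((q : ℚ) ^ 2 + 1) +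
      ((A - 1) * (q : ℚ) ^ 2 * B * ((q : ℚ) - 1) / 4 + (B - 1) * (q : ℚ) ^ 2 * A * ((q : ℚ) - 1) / 4 +
      (q - 1 - 1) * (q : ℚ) ^ 2 * ((q : ℚ) ^ 2 + 1) / 2) =
      ((q : ℚ) ^ 2 + 1) * ((q : ℚ) ^ 2 * (q - 1)) := by
    rw [hAQ, hBQ]
    linear_combination (-(q : ℚ) ^ 2 * (q - 1) / 2) * httQ
  have hle := htot ({1, 2, 4} ∪ D)
  rw [hsum] at hle
  rw [eA] at sA
  rw [eB] at sB
  rw [eC] at sC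
  have t1 : M 1 = 1 := by linarith
  have t2 : M 2 = ((q : ℚ) - 1) * ((q : ℚ) ^ 2 + 1) := by linarith
  have t4 : M 4 = (q : ℚ) * ((q : ℚ) - 1) * ((q : ℚ) ^ 2 + 1) := by linarith
  have tA := (Finset.sum_eq_sum_iff_of_le fun i (hi : i ∈ A.divisors.erase 1) =>
    lA i ((hmem hAp).1 hi).1 ((hmem hAp).1 hi).2).1 (by rw [eA]; linarith)
  have tB := (Finset.sum_eq_sum_iff_of_le fun i (hi : i ∈ B.divisors.erase 1) =>
    lB i ((hmem hBp).1 hi).1 ((hmem hBp).1 hi).2).1 (by rw [eB]; linarith)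
  have tC := (Finset.sum_eq_sum_iff_of_le fun i (hi : i ∈ (q - 1).divisors.erase 1) =>
    lC i ((hmem hCp).1 hi).1 ((hmem hCp).1 hi).2).1 (by rw [eC]; linarith)
  have hpos {i} : 0 < M i ↔ i ∈ spectrumOrders (Sz m F) := by
    rw [← numOrder_pos_iff]; exact Nat.cast_pos
  refine ⟨Nat.cast_eq_one.1 t1, t2, t4, fun i hi hin => (tA i ((hmem hAp).2 ⟨hi, hin⟩)).symm,
    fun i hi hin => (tB i ((hmem hBp).2 ⟨hi, hin⟩)).symm,
    fun i hi hin => (tC i ((hmem hCp).2 ⟨hi, hin⟩)).symm, fun i => ⟨fun hi => ?_, fun hi => ?_⟩⟩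
  · by_contra hcon
    have hni : i ∉ {1, 2, 4} ∪ D := by
      rw [Finset.mem_union, hDmem]
      simp only [Finset.mem_insert, Finset.mem_singleton, or_assoc]
      exact hcon
    -- A further element order would contribute a positive count to a sum that already exhausts |S|.
    have h1 := htot (insert i ({1, 2, 4} ∪ D))
    rw [Finset.sum_insert hni, hsum] at h1
    have := hpos.2 hi
    linarith
  · rw [← hpos]
    have hφ (h : 1 < i) : (0 : ℚ) < i.totient := by
      exact_mod_cast Nat.totient_pos.2 (by omega)
    rcases hi with rfl | rfl | rfl | ⟨hi, h⟩ | ⟨hi, h⟩ | ⟨hi, h⟩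
    · rw [t1]; norm_num
    · rw [t2]; positivity
    · rw [t4]; positivity
    · have := hφ hi
      exact lt_of_lt_of_le (by positivity) (lA i hi h)
    · have := hφ hi
      exact lt_of_lt_of_le (by positivity) (lB i hi h)
    · have := hφ hi
      exact lt_of_lt_of_le (by positivity) (lC i hi h)

end Suzuki

theorem proposition3p3 (m q r : ℕ) (hq : q = 2 ^ (2 * m + 1)) (hq8 : 8 ≤ q)
    (hr : r ^ 2 = 2 * q) (F : Type*) [Field F] (hF : Nat.card F = q) :
    (numOrder (Suzuki.Sz m F) 1 = 1 ∧
      (numOrder (Suzuki.Sz m F) 2 : ℚ) = ((q : ℚ) - 1) * ((q : ℚ) ^ 2 + 1) ∧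
      (numOrder (Suzuki.Sz m F) 4 : ℚ) = (q : ℚ) * ((q : ℚ) - 1) * ((q : ℚ) ^ 2 + 1) ∧
      (∀ i : ℕ, 1 < i → (i : ℤ) ∣ (q : ℤ) + r + 1 →
        (numOrder (Suzuki.Sz m F) i : ℚ) =
          (Nat.totient i : ℚ) * (q : ℚ) ^ 2 * ((q : ℚ) - r + 1) * ((q : ℚ) - 1) / 4) ∧
      (∀ i : ℕ, 1 < i → (i : ℤ) ∣ (q : ℤ) - r + 1 →
        (numOrder (Suzuki.Sz m F) i : ℚ) =
          (Nat.totient i : ℚ) * (q : ℚ) ^ 2 * ((q : ℚ) + r + 1) * ((q : ℚ) - 1) / 4) ∧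
      (∀ i : ℕ, 1 < i → (i : ℤ) ∣ (q : ℤ) - 1 →
        (numOrder (Suzuki.Sz m F) i : ℚ) =
          (Nat.totient i : ℚ) * (q : ℚ) ^ 2 * ((q : ℚ) ^ 2 + 1) / 2)) ∧
    (fun n : ℕ => (n : ℚ)) '' nse (Suzuki.Sz m F) =
      {1, ((q : ℚ) - 1) * ((q : ℚ) ^ 2 + 1), (q : ℚ) * ((q : ℚ) - 1) * ((q : ℚ) ^ 2 + 1)} ∪
      {x : ℚ | ∃ i : ℕ, 1 < i ∧ (i : ℤ) ∣ (q : ℤ) + r + 1 ∧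
        x = (Nat.totient i : ℚ) * (q : ℚ) ^ 2 * ((q : ℚ) - r + 1) * ((q : ℚ) - 1) / 4} ∪
      {x : ℚ | ∃ i : ℕ, 1 < i ∧ (i : ℤ) ∣ (q : ℤ) - r + 1 ∧
        x = (Nat.totient i : ℚ) * (q : ℚ) ^ 2 * ((q : ℚ) + r + 1) * ((q : ℚ) - 1) / 4} ∪
      {x : ℚ | ∃ i : ℕ, 1 < i ∧ (i : ℤ) ∣ (q : ℤ) - 1 ∧
        x = (Nat.totient i : ℚ) * (q : ℚ) ^ 2 * ((q : ℚ) ^ 2 + 1) / 2} := by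
  obtain rfl : r = 2 ^ (m + 1) := by
    apply Nat.pow_left_injective (n := 2) (by norm_num)
    simp only [hr, hq]
    ring
  have hFq : Nat.card F = 2 ^ (2 * m + 1) := hF.trans hq
  have : Finite F := Nat.finite_of_card_ne_zero (by omega)
  have := Fintype.ofFinite F
  have : CharP F 2 := charP_of_card_eq_prime_pow (f := 2 * m + 1)
    (by rw [← hFq, Nat.card_eq_fintype_card])
  have htq : 2 ^ (m + 1) ≤ q := hq ▸ Nat.pow_le_pow_right (by norm_num) (by omega)
  obtain ⟨B, hB⟩ : ∃ B, B + 2 ^ (m + 1) = q + 1 := ⟨q + 1 - 2 ^ (m + 1), by omega⟩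
  obtain ⟨h1, h2, h4, hA', hB', hC', hspec⟩ := Suzuki.numOrder_Sz_eq F m hFq hF rfl hB
  have hBQ : (B : ℚ) = (q : ℚ) - (2 ^ (m + 1) : ℕ) + 1 := by
    have := congrArg (Nat.cast : ℕ → ℚ) hB
    push_cast at this ⊢
    linarith
  have dA (i : ℕ) : (i : ℤ) ∣ (q : ℤ) + (2 ^ (m + 1) : ℕ) + 1 ↔ i ∣ q + 2 ^ (m + 1) + 1 := by
    rw [← Int.natCast_dvd_natCast]; push_cast; rfl
  have dB (i : ℕ) : (i : ℤ) ∣ (q : ℤ) - (2 ^ (m + 1) : ℕ) + 1 ↔ i ∣ B := by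
    rw [← Int.natCast_dvd_natCast, show (B : ℤ) = (q : ℤ) - (2 ^ (m + 1) : ℕ) + 1 by omega]
  have dC (i : ℕ) : (i : ℤ) ∣ (q : ℤ) - 1 ↔ i ∣ q - 1 := by
    rw [← Int.natCast_dvd_natCast, Nat.cast_sub (by omega), Nat.cast_one]
  have hAQ : ((q + 2 ^ (m + 1) + 1 : ℕ) : ℚ) = (q : ℚ) + (2 ^ (m + 1) : ℕ) + 1 := by push_cast; rfl
  simp only [dA, dB, dC]
  rw [hBQ] at hA'
  rw [hAQ] at hB'
  refine ⟨⟨h1, h2, h4, hA', hB', hC'⟩, ?_⟩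
  ext x
  simp only [Set.mem_image, nse, Set.mem_ofPred_eq, Set.mem_union, Set.mem_insert_iff,
    Set.mem_singleton_iff]
  constructor
  · rintro ⟨n, ⟨i, hi, rfl⟩, rfl⟩
    rcases (hspec i).1 hi with rfl | rfl | rfl | ⟨hi, h⟩ | ⟨hi, h⟩ | ⟨hi, h⟩
    · exact Or.inl (Or.inl (Or.inl (Or.inl (by rw [h1, Nat.cast_one]))))
    · exact Or.inl (Or.inl (Or.inl (Or.inr (Or.inl h2))))
    · exact Or.inl (Or.inl (Or.inl (Or.inr (Or.inr h4))))
    · exact Or.inl (Or.inl (Or.inr ⟨i, hi, h, hA' i hi h⟩))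
    · exact Or.inl (Or.inr ⟨i, hi, h, hB' i hi h⟩)
    · exact Or.inr ⟨i, hi, h, hC' i hi h⟩
  · rintro ((((rfl | rfl | rfl) | ⟨i, hi, h, rfl⟩) | ⟨i, hi, h, rfl⟩) | ⟨i, hi, h, rfl⟩)
    · exact ⟨_, ⟨1, (hspec 1).2 (by simp), rfl⟩, by rw [h1, Nat.cast_one]⟩
    · exact ⟨_, ⟨2, (hspec 2).2 (by simp), rfl⟩, h2⟩
    · exact ⟨_, ⟨4, (hspec 4).2 (by simp), rfl⟩, h4⟩
    · exact ⟨_, ⟨i, (hspec i).2 (by tauto), rfl⟩, hA' i hi h⟩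
    · exact ⟨_, ⟨i, (hspec i).2 (by tauto), rfl⟩, hB' i hi h⟩
    · exact ⟨_, ⟨i, (hspec i).2 (by tauto), rfl⟩, hC' i hi h⟩
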